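/- **Model.** In online multi-item JRP there are items $V=\{v_1,\dots,v_n\}$ with costs $c(v)\ge 0$ and a joint cost $c(r)>0$. A finite sequence $\sigma$ of requests is given. A request $p$ has an item $v_p$, an arrival time $a_p$, a deadline $d_p\ge a_p$ and a cost function $c_p:[a_p,\infty)\to\mathbb R_{\ge 0}$ which is non-increasing on $[a_p,d_p]$ (holding cost), and non-decreasing and continuous on $[d_p,\infty)$ (backlog cost); these functions are arbitrary otherwise and may differ from request to request. We assume that the backlog cost of each $p$ eventually reaches $c(r)+c(v_p)$. A schedule is a finite list of services; a service has a time $t$, a set of items $I$ and a set of requests $Q$ with $a_p\le t$ and $v_p\in I$ for $p\in Q$; every request is satisfied by exactly one service. The cost of such a service is $c(r)+\sum_{v\in I}c(v)+\sum_{p\in Q}c_p(t)$. $OPT(\sigma)$ is the infimum of the total costs of all schedules. **Notation.** At time $t$, a request is *active* if $a_p\le t$ and it is not yet satisfied, and an active request is *overdue* if $d_p\le t$. Let $b_t(v)$ be the sum of $c_p(t)$ over the overdue requests for $v$. An item is *mature* if $b_t(v)\ge c(v)$, and *premature* otherwise. Put $b_t(r)=\sum_{v\text{ mature}}(b_t(v)-c(v))$.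 For $t\le d_p$ the *virtual deadline* of $p$ with respect to $t$ is the first time $s\ge d_p$ with $c_p(s)=c_p(t)$ ($\infty$ if there is none). For a premature item $v$ with an active request, $\widehat{mature}_t(v)$ is the least $s\ge t$ ($\infty$ if there is none) such that $$\sum_{p\text{ active for }v,\ d_p\le t}c_p(s)\;+\sum_{p\text{ active for }v,\ t<d_p\le s,\ c_p(t)\le c_p(s)}c_p(s)\;\ge\; c(v).$$ **Algorithm.** Whenever $b_t(r)$ reaches $c(r)$, trigger a service at this time $t$, as follows. 1. *Mature backlog phase*: include all mature items and satisfy their overdue requests. 2. *Premature backlog phase*: go through the premature items that have an active request in non-decreasing order of $\widehat{mature}_t$ and include them one by one, as long as the sum of their costs is at most $2c(r)$ (stop at the first item that would exceed this); satisfy their overdue requests. 3. *Local holding phase*: for each included item $v$, go through the remaining active requests for $v$ of cost at most $c(v)$ at time $t$ in non-decreasing order of their virtual deadlines with respect to $t$ and satisfy them one by one, as long as the sum of their costs at time $t$ is at most $2c(v)$. 4. *Global holding phase*: do the same with the remaining active requests of cost at most $c(r)$ for all included items together, as long as the sum of their costs is at most $2c(r)$. Ties are broken by a fixed rule. **Theorem.**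 This algorithm is deterministic and online (its services up to time $t$ depend only on the requests that arrive up to time $t$), it satisfies all requests, and it is $16$-competitive: $ALG(\sigma)\le 16\cdot OPT(\sigma)$ for every $\sigma$. It runs in polynomial time: there is one polynomial $P$ such that its number of steps on $n$ items and $m$ requests is at most $P(n+m)$. Steps are counted as follows. Every addition or comparison of numbers or times, comparison of items, evaluation of a cost function, computation of a virtual deadline, and visit of a list entry costs one step. Computing $\widehat{mature}_t(v)$, or the next time at which $b_t(r)$ reaches $c(r)$, costs one step plus the number of requests (and items) in the list it is computed from. -/

import Mathlib

namespace JRP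

/-! ## The joint replenishment problem with holding and backlog costs -/

/-- A request for one of `n` items. Its cost function is used at times `t ≥ arrival` only: it is
non-increasing (holding cost) up to the deadline, non-decreasing and continuous (backlog cost)
from the deadline on. -/
structure Request (n : ℕ) where
  item : Fin n
  arrival : ℝ
  deadline : ℝ
  cost : ℝ → ℝ
  arrival_le_deadline : arrival ≤ deadline
  cost_nonneg : ∀ t, arrival ≤ t → 0 ≤ cost t
  holding_antitone : AntitoneOn cost (Set.Icc arrival deadline)
  backlog_monotone : MonotoneOn cost (Set.Ici deadline)
  backlog_continuous : ContinuousOn cost (Set.Ici deadline)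

/-- The joint cost `c(r)` and the item costs `c(v)`. -/
structure Costs (n : ℕ) where
  root : ℝ
  item : Fin n → ℝ
  root_pos : 0 < root
  item_nonneg : ∀ v, 0 ≤ item v

/-- The backlog cost of `p` eventually reaches `c(r) + c(v_p)`. -/
def EventuallyUrgent {n : ℕ} (K : Costs n) (p : Request n) : Prop :=
  ∃ t, p.deadline ≤ t ∧ K.root + K.item p.item ≤ p.cost t

/-- A service: its time, the items included in it and the requests satisfied by it. -/
structure Service (n m : ℕ) where
  time : ℝ
  items : Finset (Fin n)
  reqs : Finset (Fin m)

/-- The schedule `L` satisfies every request of `σ` exactly once, not before its arrival, and by a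
service that includes the requested item. -/
structure Feasible {n m : ℕ} (σ : Fin m → Request n) (L : List (Service n m)) : Prop where
  arrived : ∀ S ∈ L, ∀ p ∈ S.reqs, (σ p).arrival ≤ S.time
  item_mem : ∀ S ∈ L, ∀ p ∈ S.reqs, (σ p).item ∈ S.items
  served : ∀ p, ∃ S ∈ L, p ∈ S.reqs
  once : L.Pairwise fun S T => Disjoint S.reqs T.reqs

/-- Service cost plus holding and backlog costs of a schedule. -/
noncomputable def totalCost {n m : ℕ} (K : Costs n) (σ : Fin m → Request n)
    (L : List (Service n m)) : ℝ :=
  (L.map fun S =>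
    K.root + ∑ v ∈ S.items, K.item v + ∑ p ∈ S.reqs, (σ p).cost S.time).sum

/-- The optimal offline cost `OPT(σ)`. -/
noncomputable def optCost {n m : ℕ} (K : Costs n) (σ : Fin m → Request n) : ℝ :=
  sInf {x | ∃ L : List (Service n m), Feasible σ L ∧ x = totalCost K σ L}

/-! ## Quantities used by the algorithm -/

/-- The virtual deadline of `p` with respect to `t`: the first time after the deadline at which the
backlog cost equals the cost at time `t` (`⊤` if there is none). -/
noncomputable def virtualDeadline {n : ℕ} (p : Request n) (t : ℝ) : EReal :=
  sInf ((fun s : ℝ => (s : EReal)) '' {s | p.deadline ≤ s ∧ p.cost s = p.cost t})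

/-- `b_t(v)`: the backlog at time `t` of the overdue requests for `v` in the list `U`. -/
noncomputable def backlog {n m : ℕ} (σ : Fin m → Request n) (U : List (Fin m)) (v : Fin n)
    (t : ℝ) : ℝ :=
  ((U.filter fun p => decide ((σ p).item = v ∧ (σ p).deadline ≤ t)).map
    fun p => (σ p).cost t).sum

/-- `b_t(r)`: the sum of the surplus backlogs of the mature items. -/
noncomputable def surplus {n m : ℕ} (K : Costs n) (σ : Fin m → Request n) (U : List (Fin m))
    (t : ℝ) : ℝ :=
  ∑ v : Fin n, if K.item v ≤ backlog σ U v t then backlog σ U v t - K.item v else 0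

/-- The first time at which `b_t(r)` reaches `c(r)` if the requests in `U` stay unsatisfied.
Requests that have not arrived by time `t` are not overdue and do not contribute to `b_t(r)`. -/
noncomputable def triggerTime {n m : ℕ} (K : Costs n) (σ : Fin m → Request n)
    (U : List (Fin m)) : Option ℝ :=
  open Classical in
  if ∃ t, K.root ≤ surplus K σ U t then some (sInf {t | K.root ≤ surplus K σ U t}) else none

/-- The quantity "mature-hat" of the item `v` at time `t`, for the list `A` of requests active at
time `t` (`⊤` if the threshold is never reached). -/
noncomputable def matureHat {n m : ℕ} (K : Costs n) (σ : Fin m → Request n) (A : List (Fin m))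
    (t : ℝ) (v : Fin n) : EReal :=
  sInf ((fun s : ℝ => (s : EReal)) '' {s | t ≤ s ∧ K.item v ≤
    ((A.filter fun p => decide ((σ p).item = v ∧ (σ p).deadline ≤ t)).map
      fun p => (σ p).cost s).sum +
    ((A.filter fun p => decide ((σ p).item = v ∧ t < (σ p).deadline ∧ (σ p).deadline ≤ s ∧
        (σ p).cost t ≤ (σ p).cost s)).map fun p => (σ p).cost s).sum})

/-! ## Computations with a step count -/

/-- A result together with the number of steps spent on it. -/
structure Timed (α : Type) where
  val : α
  steps : ℕ

namespace Timed

instance : Monad Timed where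
  pure a := ⟨a, 0⟩
  bind x f := ⟨(f x.val).val, x.steps + (f x.val).steps⟩

/-- Spend `k` steps. -/
def tick (k : ℕ) : Timed Unit := ⟨(), k⟩

/-! Unit-cost operations on numbers, times, requests and items. -/

noncomputable def le (x y : ℝ) : Timed Bool := ⟨decide (x ≤ y), 1⟩

noncomputable def leTime (x y : EReal) : Timed Bool := ⟨decide (x ≤ y), 1⟩

noncomputable def add (x y : ℝ) : Timed ℝ := ⟨x + y, 1⟩

def sameItem {n : ℕ} (v w : Fin n) : Timed Bool := ⟨decide (v = w), 1⟩

/-- Evaluation of a cost function. -/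
def evalCost {n : ℕ} (p : Request n) (t : ℝ) : Timed ℝ := ⟨p.cost t, 1⟩

/-- The first time at which one cost function takes a given value again. -/
noncomputable def virtualDeadline {n : ℕ} (p : Request n) (t : ℝ) : Timed EReal :=
  ⟨JRP.virtualDeadline p t, 1⟩

/-! The two operations that determine when a quantity composed of several cost functions reaches a
threshold. They are charged for the number of cost functions and item costs involved. -/

noncomputable def matureHat {n m : ℕ} (K : Costs n) (σ : Fin m → Request n) (A : List (Fin m))
    (t : ℝ) (v : Fin n) : Timed EReal :=
  ⟨JRP.matureHat K σ A t v, 1 + A.length⟩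

noncomputable def triggerTime {n m : ℕ} (K : Costs n) (σ : Fin m → Request n)
    (U : List (Fin m)) : Timed (Option ℝ) :=
  ⟨JRP.triggerTime K σ U, 1 + U.length + n⟩

/-! List operations, one step per list cell visited, in addition to the steps of the arguments. -/

/-- The entries of a list that satisfy a test, and the other ones. -/
def partition {α : Type} (q : α → Timed Bool) : List α → Timed (List α × List α)
  | [] => pure ([], [])
  | a :: l => do
    tick 1
    let b ← q a
    let r ← partition q l
    if b then pure (a :: r.1, r.2) else pure (r.1, a :: r.2)

def append {α : Type} (l l' : List α) : Timed (List α) := do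
  tick (1 + l.length)
  pure (l ++ l')

/-- Is there an entry that satisfies a test? -/
def any {α : Type} (q : α → Timed Bool) : List α → Timed Bool
  | [] => pure false
  | a :: l => do
    tick 1
    let b ← q a
    if b then pure true else any q l

noncomputable def sum {α : Type} (f : α → Timed ℝ) : List α → Timed ℝ
  | [] => pure 0
  | a :: l => do
    tick 1
    let x ← f a
    let y ← sum f l
    add x y

/-- Insertion into a list that is sorted by non-decreasing keys. -/
noncomputable def insert {α : Type} (key : α → Timed EReal) (a : α) : List α → Timed (List α)
  | [] => do
    tick 1
    pure [a]
  | b :: l => do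
    tick 1
    let x ← key a
    let y ← key b
    let c ← leTime x y
    if c then pure (a :: b :: l) else do
      let r ← insert key a l
      pure (b :: r)

/-- Stable sorting by non-decreasing keys. -/
noncomputable def sort {α : Type} (key : α → Timed EReal) : List α → Timed (List α)
  | [] => pure []
  | a :: l => do
    tick 1
    let r ← sort key l
    insert key a r

/-- Go through the list and take its entries one by one, as long as `acc` plus the sum of the
values of the entries taken is at most `cap`. Returns the entries taken and the remaining ones. -/
noncomputable def takePrefix {α : Type} (f : α → Timed ℝ) (cap : ℝ) :
    ℝ → List α → Timed (List α × List α)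
  | _, [] => pure ([], [])
  | acc, a :: l => do
    tick 1
    let x ← f a
    let s ← add acc x
    let c ← le s cap
    if c then do
      let r ← takePrefix f cap s l
      pure (a :: r.1, r.2)
    else pure ([], a :: l)

end Timed

/-! ## The algorithm -/

section Algorithm

open Timed

/-- Membership of the item of a request in a list of items. -/
def itemIn {n m : ℕ} (σ : Fin m → Request n) (I : List (Fin n)) (p : Fin m) : Timed Bool :=
  any (fun v => sameItem v (σ p).item) I

/-- Is `p` an overdue request for an item in the list `I`? -/
noncomputable def overdueIn {n m : ℕ} (σ : Fin m → Request n) (t : ℝ) (I : List (Fin n))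
    (p : Fin m) : Timed Bool := do
  let b ← le (σ p).deadline t
  if b then itemIn σ I p else pure false

/-- Is `v` mature at time `t`, where `A` is the list of active requests? -/
noncomputable def isMature {n m : ℕ} (K : Costs n) (σ : Fin m → Request n) (A : List (Fin m))
    (t : ℝ) (v : Fin n) : Timed Bool := do
  let o ← partition (overdueIn σ t [v]) A
  let b ← sum (fun p => evalCost (σ p) t) o.1
  le (K.item v) b

/-- The requests served in a holding phase at time `t`, and the remaining ones: among the requests
in `R` for items in `I`, consider those with cost at most `c` at time `t` in non-decreasing
order of their virtual deadlines, as long as the sum of their costs is at most `2 * c`. -/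
noncomputable def holdingPhase {n m : ℕ} (σ : Fin m → Request n) (t c : ℝ) (I : List (Fin n))
    (R : List (Fin m)) : Timed (List (Fin m) × List (Fin m)) := do
  let cand ← partition (fun p => do
    let i ← itemIn σ I p
    if i then do
      let x ← evalCost (σ p) t
      le x c
    else pure false) R
  let srt ← sort (fun p => Timed.virtualDeadline (σ p) t) cand.1
  let cap ← add c c
  let taken ← takePrefix (fun p => evalCost (σ p) t) cap 0 srt
  let rest ← append taken.2 cand.2
  pure (taken.1, rest)

/-- The local holding phases of the items in a list, one item after the other. -/
noncomputable def localPhases {n m : ℕ} (K : Costs n) (σ : Fin m → Request n) (t : ℝ) :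
    List (Fin n) → List (Fin m) → Timed (List (Fin m) × List (Fin m))
  | [], R => pure ([], R)
  | v :: I, R => do
    tick 1
    let h ← holdingPhase σ t (K.item v) [v] R
    let r ← localPhases K σ t I h.2
    let taken ← append h.1 r.1
    pure (taken, r.2)

/-- The service triggered at time `t` when `U` is the list of unsatisfied requests. Returns the
service and the list of requests that are still unsatisfied. -/
noncomputable def serve {n m : ℕ} (K : Costs n) (σ : Fin m → Request n) (t : ℝ)
    (U : List (Fin m)) : Timed (Service n m × List (Fin m)) := do
  -- the active requests, and the ones that have not arrived yet
  let act ← partition (fun p => le (σ p).arrival t) U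
  tick n
  let allItems := List.finRange n
  -- mature backlog phase
  let items ← partition (isMature K σ act.1 t) allItems
  let b1 ← partition (overdueIn σ t items.1) act.1
  -- premature backlog phase
  let prem ← partition (fun v => any (fun p => sameItem v (σ p).item) act.1) items.2
  let srt ← sort (Timed.matureHat K σ act.1 t) prem.1
  let cap ← add K.root K.root
  let chosen ← takePrefix (fun v => pure (K.item v)) cap 0 srt
  let b2 ← partition (overdueIn σ t chosen.1) b1.2
  -- local holding phase
  let incl ← append items.1 chosen.1
  let h1 ← localPhases K σ t incl b2.2
  -- global holding phase
  let h2 ← holdingPhase σ t K.root incl h1.2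
  -- output
  let q2 ← append h1.1 h2.1
  let q1 ← append b2.1 q2
  let q ← append b1.1 q1
  let rest ← append h2.2 act.2
  tick (incl.length + q.length)
  pure (⟨t, incl.toFinset, q.toFinset⟩, rest)

/-- At most `k` successive services, starting with the list `U` of unsatisfied requests. -/
noncomputable def run {n m : ℕ} (K : Costs n) (σ : Fin m → Request n) :
    ℕ → List (Fin m) → Timed (List (Service n m))
  | 0, _ => pure []
  | k + 1, U => do
    let t ← Timed.triggerTime K σ U
    match t with
    | none => pure []
    | some t => do
      let s ← serve K σ t U
      let L ← run K σ k s.2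
      pure (s.1 :: L)

/-- A deterministic algorithm with a step count, mapping a sequence of requests to a schedule. -/
abbrev Algorithm : Type :=
  ∀ ⦃n m : ℕ⦄, Costs n → (Fin m → Request n) → Timed (List (Service n m))

/-- The four-phase algorithm. Each service satisfies at least one request, so `m` rounds suffice
for `m` requests. -/
noncomputable def fourPhase : Algorithm := fun _ m K σ => do
  tick m
  run K σ m (List.finRange m)

end Algorithm

/-! ## Properties of algorithms -/

/-- `alg` satisfies all requests, at a cost of at most `α` times the optimal offline cost. -/
def IsCompetitive (α : ℝ) (alg : Algorithm) : Prop :=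
  ∀ (n m : ℕ) (K : Costs n) (σ : Fin m → Request n), (∀ p, EventuallyUrgent K (σ p)) →
    Feasible σ (alg K σ).val ∧ totalCost K σ (alg K σ).val ≤ α * optCost K σ

/-- The services of a schedule up to time `t`, with the requests named by their positions. -/
noncomputable def servicesUpTo {n m : ℕ} (t : ℝ) (L : List (Service n m)) :
    List (ℝ × Finset (Fin n) × Finset ℕ) :=
  (L.filter fun S => decide (S.time ≤ t)).map
    fun S => (S.time, S.items, S.reqs.map Fin.valEmbedding)

/-- The services of `alg` up to time `t` depend only on the requests that arrive up to time `t`. -/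
def IsOnline (alg : Algorithm) : Prop :=
  ∀ (n m m' : ℕ) (K : Costs n) (σ : Fin m → Request n) (σ' : Fin m' → Request n) (t : ℝ),
    (∀ (i : ℕ) (p : Request n), p.arrival ≤ t →
      ((∃ h : i < m, σ ⟨i, h⟩ = p) ↔ ∃ h : i < m', σ' ⟨i, h⟩ = p)) →
    servicesUpTo t (alg K σ).val = servicesUpTo t (alg K σ').val

/-- The number of steps is at most polynomial in the number of items and requests. -/
def RunsInPolynomialTime (alg : Algorithm) : Prop :=
  ∃ P : Polynomial ℕ, ∀ (n m : ℕ) (K : Costs n) (σ : Fin m → Request n),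
    (alg K σ).steps ≤ P.eval (n + m)

end JRP

/-!
The time bound and the online property follow from the structure of the algorithm: every phase is a
pass over lists of items and requests (`serve_length_steps`), and neither a service at time `t` nor
the decision to trigger one looks at requests that arrive after `t` (`serve_congr`,
`surplus_congr`). Backlogs are monotone and right-continuous, so the trigger time is attained
(`triggerTime_eq_some_iff`), and it depends only on the surplus up to that time.

For the competitive ratio, a run is cut into rounds (`Round`, `Trace`), and the rounds are compared
with an arbitrary feasible schedule `L` that satisfies the request `p` at time `o p`. In a round,
let `M` be the set of mature items, `P` the set of premature items that are included, and `B` the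
surplus backlog. The caps of the phases bound the cost of the round by `11 c(r) + B + 4 c(M)`
(`Round.FollowsPhases.cost_le`). Here `B` can exceed `c(r)` only by the costs of requests whose
deadline is the time of the service (`Round.surplus_le`), and `L` pays at least as much for them.

* The cost of a mature item `v` is charged to the services of `L` for `v` since the last round that
  included `v`. If there are none, then `L` satisfies all requests for `v` before that round or
  after the current one. Either it pays `c(v)` for the overdue requests, or the local holding phase
  of that last round was full of requests with earlier virtual deadlines, for which `L` pays `c(v)`
  (`Trace.item_le_of_mature`).
* The joint cost is charged to a service of `L` since the preceding round. If there is none, then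
  (`Trace.surplus_cases`) `L` pays enough for the overdue requests, or for the requests of the
  global holding phase of the preceding round, or else some item, now mature, was left out of the
  preceding round although its maturity was foreseen. In the last case all of `P` in that round and
  the item `w` at which its premature phase stopped were predicted to be mature by now, and
  `c(P) + c(w) > 2 c(r)`. So half of the cost of each of these items pays for `c(r)`; each of them
  is charged as a mature item is, and for `u` in `P` also to its requests in the holding phases of
  the preceding round (`Trace.item_le_of_premature`, `Trace.root_le_of_left_out`).

`Trace.cost_le_charge` collects these bounds. The windows between successive rounds that include an
item are disjoint, and every request belongs to one phase of one round; so in the sum over all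
rounds (`Trace.sum_cost_le`) no part of the cost of `L` is charged more than 16 times. For example,
a request of a local holding phase of `v` is charged 6 times for the premature item `v` of the same
round and at most 10 times by the next round that includes `v`.
-/

namespace JRP

namespace Timed

/-! ### Values and step counts of the timed list operations -/

section Basic

variable {α β : Type}

@[simp] theorem val_pure (a : α) : (pure a : Timed α).val = a := rfl

@[simp] theorem steps_pure (a : α) : (pure a : Timed α).steps = 0 := rfl

@[simp] theorem val_bind (x : Timed α) (f : α → Timed β) : (x >>= f).val = (f x.val).val := rfl

@[simp] theorem steps_bind (x : Timed α) (f : α → Timed β) :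
    (x >>= f).steps = x.steps + (f x.val).steps := rfl

@[simp] theorem steps_tick (k : ℕ) : (tick k).steps = k := rfl

@[simp] theorem val_le (x y : ℝ) : (le x y).val = decide (x ≤ y) := rfl

@[simp] theorem steps_le (x y : ℝ) : (le x y).steps = 1 := rfl

@[simp] theorem val_leTime (x y : EReal) : (leTime x y).val = decide (x ≤ y) := rfl

@[simp] theorem steps_leTime (x y : EReal) : (leTime x y).steps = 1 := rfl

@[simp] theorem val_add (x y : ℝ) : (add x y).val = x + y := rfl

@[simp] theorem steps_add (x y : ℝ) : (add x y).steps = 1 := rfl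

@[simp] theorem val_sameItem {n : ℕ} (v w : Fin n) : (sameItem v w).val = decide (v = w) := rfl

@[simp] theorem steps_sameItem {n : ℕ} (v w : Fin n) : (sameItem v w).steps = 1 := rfl

@[simp] theorem val_evalCost {n : ℕ} (p : Request n) (t : ℝ) : (evalCost p t).val = p.cost t := rfl

@[simp] theorem steps_evalCost {n : ℕ} (p : Request n) (t : ℝ) : (evalCost p t).steps = 1 := rfl

@[simp] theorem val_virtualDeadline {n : ℕ} (p : Request n) (t : ℝ) :
    (Timed.virtualDeadline p t).val = JRP.virtualDeadline p t := rfl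

@[simp] theorem steps_virtualDeadline {n : ℕ} (p : Request n) (t : ℝ) :
    (Timed.virtualDeadline p t).steps = 1 := rfl

@[simp] theorem val_matureHat {n m : ℕ} (K : Costs n) (σ : Fin m → Request n) (A : List (Fin m))
    (t : ℝ) (v : Fin n) : (Timed.matureHat K σ A t v).val = JRP.matureHat K σ A t v := rfl

@[simp] theorem steps_matureHat {n m : ℕ} (K : Costs n) (σ : Fin m → Request n)
    (A : List (Fin m)) (t : ℝ) (v : Fin n) :
    (Timed.matureHat K σ A t v).steps = 1 + A.length := rfl

@[simp] theorem val_triggerTime {n m : ℕ} (K : Costs n) (σ : Fin m → Request n)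
    (U : List (Fin m)) : (Timed.triggerTime K σ U).val = JRP.triggerTime K σ U := rfl

@[simp] theorem steps_triggerTime {n m : ℕ} (K : Costs n) (σ : Fin m → Request n)
    (U : List (Fin m)) : (Timed.triggerTime K σ U).steps = 1 + U.length + n := rfl

@[simp] theorem val_partition (q : α → Timed Bool) (l : List α) :
    (partition q l).val = (l.filter (fun a => (q a).val), l.filter (fun a => !(q a).val)) := by
  induction l with
  | nil => simp [partition]
  | cons a l ih => cases h : (q a).val <;> simp [partition, h, ih]

@[simp] theorem val_append (l l' : List α) : (append l l').val = l ++ l' := by simp [append]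

@[simp] theorem steps_append (l l' : List α) : (append l l').steps = 1 + l.length := by
  simp [append]

@[simp] theorem val_any (q : α → Timed Bool) (l : List α) :
    (any q l).val = l.any (fun a => (q a).val) := by
  induction l with
  | nil => simp [any]
  | cons a l ih => cases h : (q a).val <;> simp [any, h, ih]

@[simp] theorem val_sum (f : α → Timed ℝ) (l : List α) :
    (sum f l).val = (l.map (fun a => (f a).val)).sum := by
  induction l with
  | nil => simp [sum]
  | cons a l ih => simp [sum, ih]

@[simp] theorem val_insert (key : α → Timed EReal) (a : α) (l : List α) :
    (insert key a l).val = l.orderedInsert (fun a b => (key a).val ≤ (key b).val) a := by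
  induction l with
  | nil => simp [insert]
  | cons b l ih =>
    by_cases h : (key a).val ≤ (key b).val <;> simp [insert, h, ih]

@[simp] theorem val_sort (key : α → Timed EReal) (l : List α) :
    (sort key l).val = l.insertionSort (fun a b => (key a).val ≤ (key b).val) := by
  induction l with
  | nil => simp [sort]
  | cons b l ih => simp [sort, ih]

/-- The two parts returned by `takePrefix` form a splitting of the list. -/
theorem takePrefix_append (f : α → Timed ℝ) (cap acc : ℝ) (l : List α) :
    (takePrefix f cap acc l).val.1 ++ (takePrefix f cap acc l).val.2 = l := by
  induction l generalizing acc with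
  | nil => simp [takePrefix]
  | cons a l ih =>
    by_cases h : acc + (f a).val ≤ cap
    · simpa [takePrefix, h] using ih (acc + (f a).val)
    · simp [takePrefix, h]

theorem takePrefix_sum_le (f : α → Timed ℝ) (cap acc : ℝ) (l : List α) (h0 : acc ≤ cap) :
    acc + ((takePrefix f cap acc l).val.1.map fun a => (f a).val).sum ≤ cap := by
  induction l generalizing acc with
  | nil => simpa [takePrefix] using h0
  | cons a l ih =>
    by_cases h : acc + (f a).val ≤ cap
    · simpa [takePrefix, h, add_assoc] using ih (acc + (f a).val) h
    · simpa [takePrefix, h] using h0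

/-- If `takePrefix` stops early, then the first entry left out exceeds the bound. -/
theorem lt_takePrefix_sum (f : α → Timed ℝ) (cap acc : ℝ) (l : List α) (b : α) (l' : List α)
    (h' : (takePrefix f cap acc l).val.2 = b :: l') :
    cap < acc + ((takePrefix f cap acc l).val.1.map fun a => (f a).val).sum + (f b).val := by
  induction l generalizing acc with
  | nil => simp [takePrefix] at h'
  | cons a l ih =>
    by_cases h : acc + (f a).val ≤ cap
    · have := ih (acc + (f a).val) (by simpa [takePrefix, h] using h')
      simpa [takePrefix, h, add_assoc] using this
    · simp only [takePrefix, val_bind, val_add, val_le, h, decide_false, Bool.false_eq_true,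
        if_false, val_pure, List.cons.injEq] at h' ⊢
      obtain ⟨rfl, -⟩ := h'
      simpa using h

theorem steps_partition_le {q : α → Timed Bool} {l : List α} {c : ℕ}
    (h : ∀ a, (q a).steps ≤ c) : (partition q l).steps ≤ l.length * (c + 1) := by
  induction l with
  | nil => simp [partition]
  | cons a l ih =>
    have := h a
    have h2 : ((partition q (a :: l)).steps) = 1 + ((q a).steps + (partition q l).steps) := by
      cases hq : (q a).val <;> simp [partition, hq]
    rw [h2, List.length_cons, Nat.add_mul]
    omega

theorem steps_any_le {q : α → Timed Bool} {l : List α} {c : ℕ}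
    (h : ∀ a, (q a).steps ≤ c) : (any q l).steps ≤ l.length * (c + 1) := by
  induction l with
  | nil => simp [any]
  | cons a l ih =>
    have := h a
    rw [List.length_cons, Nat.add_mul]
    cases hq : (q a).val <;> simp [any, hq] <;> omega

theorem steps_sum_le {f : α → Timed ℝ} {l : List α} {c : ℕ}
    (h : ∀ a, (f a).steps ≤ c) : (sum f l).steps ≤ l.length * (c + 2) := by
  induction l with
  | nil => simp [sum]
  | cons a l ih =>
    have := h a
    rw [List.length_cons, Nat.add_mul]
    simp [sum]
    omega

theorem steps_insert_le {key : α → Timed EReal} {a : α} {l : List α} {c : ℕ}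
    (h : ∀ a, (key a).steps ≤ c) : (insert key a l).steps ≤ (l.length + 1) * (2 * c + 2) := by
  induction l with
  | nil => simp [insert]
  | cons b l ih =>
    have h1 := h a
    have h2 := h b
    rw [List.length_cons, Nat.add_mul (l.length + 1)]
    by_cases hk : (key a).val ≤ (key b).val
    · simp [insert, hk]
      omega
    · simp [insert, hk]
      omega

theorem steps_sort_le {key : α → Timed EReal} {l : List α} {c N : ℕ}
    (h : ∀ a, (key a).steps ≤ c) (hl : l.length ≤ N) :
    (sort key l).steps ≤ l.length * (1 + (N + 1) * (2 * c + 2)) := by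
  induction l with
  | nil => simp [sort]
  | cons b l ih =>
    have hl' : l.length + 1 ≤ N := by simpa using hl
    have h1 := ih (by omega)
    have h2 : (insert key b (sort key l).val).steps ≤ (N + 1) * (2 * c + 2) := by
      refine (steps_insert_le h).trans (Nat.mul_le_mul_right _ ?_)
      rw [val_sort, List.length_insertionSort]
      omega
    rw [List.length_cons, Nat.add_mul]
    simp only [sort, steps_bind, steps_tick]
    omega

theorem steps_takePrefix_le {f : α → Timed ℝ} {cap acc : ℝ} {l : List α} {c : ℕ}
    (h : ∀ a, (f a).steps ≤ c) : (takePrefix f cap acc l).steps ≤ l.length * (c + 3) := by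
  induction l generalizing acc with
  | nil => simp [takePrefix]
  | cons a l ih =>
    have := h a
    have h3 := @ih (acc + (f a).val)
    rw [List.length_cons, Nat.add_mul]
    by_cases hk : acc + (f a).val ≤ cap
    · simp [takePrefix, hk]
      omega
    · simp [takePrefix, hk]
      omega

theorem length_partition (q : α → Timed Bool) (l : List α) :
    (partition q l).val.1.length + (partition q l).val.2.length = l.length := by
  rw [val_partition]
  exact (List.length_eq_length_filter_add _).symm

theorem length_takePrefix (f : α → Timed ℝ) (cap acc : ℝ) (l : List α) :
    (takePrefix f cap acc l).val.1.length + (takePrefix f cap acc l).val.2.length = l.length := by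
  rw [← List.length_append, takePrefix_append]

end Basic

end Timed

/-! ### Polynomial running time -/

section Steps

open Timed

variable {n m : ℕ} (K : Costs n) (σ : Fin m → Request n)

@[simp] theorem val_itemIn (I : List (Fin n)) (p : Fin m) :
    (itemIn σ I p).val = decide ((σ p).item ∈ I) := by
  simp [itemIn, List.any_eq, eq_comm]

@[simp] theorem val_overdueIn (t : ℝ) (I : List (Fin n)) (p : Fin m) :
    (overdueIn σ t I p).val = decide ((σ p).deadline ≤ t ∧ (σ p).item ∈ I) := by
  by_cases h : (σ p).deadline ≤ t <;> simp [overdueIn, h]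

theorem steps_itemIn_le (I : List (Fin n)) (p : Fin m) : (itemIn σ I p).steps ≤ 2 * I.length := by
  have := steps_any_le (q := fun v => sameItem v (σ p).item) (l := I) (c := 1) (fun a => by simp)
  unfold itemIn
  omega

theorem steps_overdueIn_le (t : ℝ) (I : List (Fin n)) (p : Fin m) :
    (overdueIn σ t I p).steps ≤ 1 + 2 * I.length := by
  have := steps_itemIn_le σ I p
  by_cases h : (σ p).deadline ≤ t
  · simp [overdueIn, h]
    omega
  · simp [overdueIn, h]

theorem steps_isMature_le (A : List (Fin m)) (t : ℝ) (v : Fin n) :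
    (isMature K σ A t v).steps ≤ 7 * A.length + 1 := by
  have h1 := steps_partition_le (q := overdueIn σ t [v]) (l := A) (c := 3)
    (fun p => (steps_overdueIn_le σ t [v] p).trans (by simp))
  have h2 := steps_sum_le (f := fun p => evalCost (σ p) t)
    (l := (partition (overdueIn σ t [v]) A).val.1) (c := 1) (fun p => by simp)
  have h3 := length_partition (overdueIn σ t [v]) A
  simp only [isMature, steps_bind, steps_le]
  omega

theorem length_holdingPhase (t c : ℝ) (I : List (Fin n)) (R : List (Fin m)) :
    (holdingPhase σ t c I R).val.1.length + (holdingPhase σ t c I R).val.2.length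
      = R.length := by
  unfold holdingPhase
  simp only [val_bind, val_pure, val_append, List.length_append]
  rw [← add_assoc, length_takePrefix, val_sort, List.length_insertionSort, length_partition]

theorem steps_holdingPhase_le {B : ℕ} (t c : ℝ) (I : List (Fin n)) (R : List (Fin m))
    (hI : I.length ≤ B) (hR : R.length + 1 ≤ B) :
    (holdingPhase σ t c I R).steps ≤ 16 * B ^ 2 := by
  unfold holdingPhase
  simp only [steps_bind, steps_add, steps_append, steps_pure]
  set q : Fin m → Timed Bool := fun p => do
      let i ← itemIn σ I p
      if i then do
        let x ← evalCost (σ p) t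
        Timed.le x c
      else pure false with hq
  have h1 := steps_partition_le (q := q) (l := R) (c := 2 * B + 2) (fun p => by
    have := steps_itemIn_le σ I p
    by_cases h : (σ p).item ∈ I <;> simp [hq, h] <;> omega)
  have hl1 := length_partition q R
  have h2 := steps_sort_le (key := fun p => Timed.virtualDeadline (σ p) t)
    (l := (partition q R).val.1) (c := 1) (N := R.length) (fun p => by simp) (by omega)
  have h3 := steps_takePrefix_le (f := fun p => evalCost (σ p) t) (cap := (Timed.add c c).val)
    (acc := 0) (l := (sort (fun p => Timed.virtualDeadline (σ p) t) (partition q R).val.1).val)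
    (c := 1) (fun p => by simp)
  have h4 := length_takePrefix (fun p => evalCost (σ p) t) (Timed.add c c).val 0
    (sort (fun p => Timed.virtualDeadline (σ p) t) (partition q R).val.1).val
  have h5 : (sort (fun p => Timed.virtualDeadline (σ p) t) (partition q R).val.1).val.length
      = (partition q R).val.1.length := by rw [val_sort, List.length_insertionSort]
  have h1' : (partition q R).steps ≤ B * (2 * B + 2 + 1) :=
    h1.trans (Nat.mul_le_mul_right _ (by omega))
  have h2' : (sort (fun p => Timed.virtualDeadline (σ p) t) (partition q R).val.1).steps
      ≤ B * (1 + B * (2 * 1 + 2)) :=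
    h2.trans (Nat.mul_le_mul (by omega) (Nat.add_le_add_left (Nat.mul_le_mul_right _ hR) _))
  have hB : B ≤ B ^ 2 := Nat.le_self_pow (by norm_num) B
  have e1 : B * (2 * B + 2 + 1) = 2 * B ^ 2 + 3 * B := by ring
  have e2 : B * (1 + B * (2 * 1 + 2)) = 4 * B ^ 2 + B := by ring
  omega

theorem length_localPhases (t : ℝ) (I : List (Fin n)) (R : List (Fin m)) :
    (localPhases K σ t I R).val.1.length + (localPhases K σ t I R).val.2.length = R.length := by
  induction I generalizing R with
  | nil => simp [localPhases]
  | cons v I ih =>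
    have h1 := length_holdingPhase σ t (K.item v) [v] R
    have h2 := ih (holdingPhase σ t (K.item v) [v] R).val.2
    simp only [localPhases, val_bind, val_pure, val_append, List.length_append]
    omega

theorem steps_localPhases_le {B : ℕ} (t : ℝ) (I : List (Fin n)) (R : List (Fin m))
    (hR : R.length + 1 ≤ B) :
    (localPhases K σ t I R).steps ≤ I.length * (18 * B ^ 2) := by
  induction I generalizing R with
  | nil => simp [localPhases]
  | cons v I ih =>
    have h1 := length_holdingPhase σ t (K.item v) [v] R
    have h2 := ih (holdingPhase σ t (K.item v) [v] R).val.2 (by omega)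
    have h3 := steps_holdingPhase_le (B := B) σ t (K.item v) [v] R (by simp; omega) hR
    have hB : B ≤ B ^ 2 := Nat.le_self_pow (by norm_num) B
    rw [List.length_cons, Nat.add_mul]
    simp only [localPhases, steps_bind, steps_pure, steps_append, steps_tick]
    omega

/-- A service does not lengthen the list of unsatisfied requests, and the number of its steps is at
most cubic. -/
theorem serve_length_steps {B : ℕ} (t : ℝ) (U : List (Fin m)) (hB : n + U.length + 1 ≤ B) :
    (serve K σ t U).val.2.length ≤ U.length ∧ (serve K σ t U).steps ≤ 100 * B ^ 3 := by
  unfold serve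
  simp only [steps_bind, steps_add, steps_append, steps_pure, steps_tick, val_bind, val_pure]
  set act := (partition (fun p => Timed.le (σ p).arrival t) U).val with hact
  set items := (partition (isMature K σ act.1 t) (List.finRange n)).val with hitems
  set b1 := (partition (overdueIn σ t items.1) act.1).val with hb1
  set prem := (partition (fun v => any (fun p => sameItem v (σ p).item) act.1) items.2).val
    with hprem
  set srt := (sort (Timed.matureHat K σ act.1 t) prem.1).val with hsrt
  set chosen := (takePrefix (fun v => (pure (K.item v) : Timed ℝ)) (Timed.add K.root K.root).val 0
    srt).val with hchosen
  set b2 := (partition (overdueIn σ t chosen.1) b1.2).val with hb2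
  simp only [val_append]
  set incl := items.1 ++ chosen.1 with hincl
  set h1 := (localPhases K σ t incl b2.2).val with hh1
  set h2 := (holdingPhase σ t K.root incl h1.2).val with hh2
  have l0 := length_partition (fun p => Timed.le (σ p).arrival t) U
  have l1 := length_partition (isMature K σ act.1 t) (List.finRange n)
  have l2 := length_partition (overdueIn σ t items.1) act.1
  have l3 := length_partition (fun v => any (fun p => sameItem v (σ p).item) act.1) items.2
  have l4 : srt.length = prem.1.length := by rw [hsrt, val_sort, List.length_insertionSort]
  have l5 := length_takePrefix (fun v => (pure (K.item v) : Timed ℝ))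
    (Timed.add K.root K.root).val 0 srt
  have l6 := length_partition (overdueIn σ t chosen.1) b1.2
  have l7 := length_localPhases K σ t incl b2.2
  have l8 := length_holdingPhase σ t K.root incl h1.2
  have l9 : incl.length = items.1.length + chosen.1.length := List.length_append
  rw [← hact] at l0
  rw [← hitems, List.length_finRange] at l1
  rw [← hb1] at l2
  rw [← hprem] at l3
  rw [← hchosen] at l5
  rw [← hb2] at l6
  rw [← hh1] at l7
  rw [← hh2] at l8
  have s0 := steps_partition_le (q := fun p => Timed.le (σ p).arrival t) (l := U) (c := 1)
    (fun p => by simp)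
  have s1 := steps_partition_le (q := isMature K σ act.1 t) (l := List.finRange n) (c := 7 * B + 1)
    (fun p => (steps_isMature_le K σ act.1 t p).trans (by omega))
  have s2 := steps_partition_le (q := overdueIn σ t items.1) (l := act.1) (c := 1 + 2 * B)
    (fun p => (steps_overdueIn_le σ t items.1 p).trans (by omega))
  have s3 := steps_partition_le (q := fun v => any (fun p => sameItem v (σ p).item) act.1)
    (l := items.2) (c := 2 * B)
    (fun v => (steps_any_le (c := 1) (fun p => by simp)).trans (by omega))
  have s4 := steps_sort_le (key := Timed.matureHat K σ act.1 t) (l := prem.1) (c := B) (N := n)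
    (fun p => by simp; omega) (by omega)
  have s5 := steps_takePrefix_le (f := fun v => (pure (K.item v) : Timed ℝ))
    (cap := (Timed.add K.root K.root).val) (acc := 0) (l := srt) (c := 0) (fun p => by simp)
  have s6 := steps_partition_le (q := overdueIn σ t chosen.1) (l := b1.2) (c := 1 + 2 * B)
    (fun p => (steps_overdueIn_le σ t chosen.1 p).trans (by omega))
  have s7 := steps_localPhases_le (B := B) K σ t incl b2.2 (by omega)
  have s8 := steps_holdingPhase_le (B := B) σ t K.root incl h1.2 (by omega) (by omega)
  replace s1 := s1.trans (Nat.mul_le_mul_right _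
    (show (List.finRange n).length ≤ B by rw [List.length_finRange]; omega))
  replace s2 := s2.trans (Nat.mul_le_mul_right _ (show act.1.length ≤ B by omega))
  replace s3 := s3.trans (Nat.mul_le_mul_right _ (show items.2.length ≤ B by omega))
  replace s4 := s4.trans (Nat.mul_le_mul (show prem.1.length ≤ B by omega)
    (Nat.add_le_add_left (Nat.mul_le_mul_right _ (show n + 1 ≤ B by omega)) _))
  replace s6 := s6.trans (Nat.mul_le_mul_right _ (show b1.2.length ≤ B by omega))
  replace s7 := s7.trans (Nat.mul_le_mul_right _ (show incl.length ≤ B by omega))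
  have e1 : B * (7 * B + 1 + 1) = 7 * B ^ 2 + 2 * B := by ring
  have e2 : B * (1 + 2 * B + 1) = 2 * B ^ 2 + 2 * B := by ring
  have e3 : B * (2 * B + 1) = 2 * B ^ 2 + B := by ring
  have e4 : B * (1 + B * (2 * B + 2)) = 2 * B ^ 3 + 2 * B ^ 2 + B := by ring
  have e5 : B * (18 * B ^ 2) = 18 * B ^ 3 := by ring
  have hB1 : 1 ≤ B := by omega
  have hB2 : B ≤ B ^ 3 := Nat.le_self_pow (by norm_num) B
  have hB3 : B ^ 2 ≤ B ^ 3 := Nat.pow_le_pow_right hB1 (by norm_num)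
  constructor
  · rw [List.length_append]
    omega
  · have hq : b1.1.length + (b2.1.length + (h1.1.length + h2.1.length)) ≤ B := by omega
    have hi : incl.length ≤ B := by omega
    have hU : U.length ≤ B := by omega
    have hn : n ≤ B := by omega
    have hp : srt.length ≤ B := by omega
    clear_value act items b1 prem srt chosen b2 incl h1 h2
    simp only [List.length_append]
    linarith

theorem steps_run_le {B : ℕ} (k : ℕ) (U : List (Fin m)) (hB : n + U.length + 1 ≤ B) :
    (run K σ k U).steps ≤ k * (101 * B ^ 3) := by
  induction k generalizing U with
  | zero => simp [run]
  | succ k ih =>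
    have hB2 : B ≤ B ^ 3 := Nat.le_self_pow (by norm_num) B
    simp only [run, steps_bind, steps_triggerTime, val_triggerTime]
    rw [Nat.add_mul]
    cases h : JRP.triggerTime K σ U with
    | none =>
      simp only [steps_pure]
      omega
    | some t =>
      obtain ⟨h1, h2⟩ := serve_length_steps K σ t U hB
      have h3 := ih (serve K σ t U).val.2 (by omega)
      simp only [steps_pure, steps_bind]
      omega

theorem fourPhase_runsInPolynomialTime : RunsInPolynomialTime fourPhase := by
  refine ⟨102 * (Polynomial.X + 1) ^ 4, fun n m K σ => ?_⟩
  have h := steps_run_le (B := n + m + 1) K σ m (List.finRange m) (by simp)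
  have h2 : m * (101 * (n + m + 1) ^ 3) ≤ (n + m + 1) * (101 * (n + m + 1) ^ 3) :=
    Nat.mul_le_mul_right _ (by omega)
  have h3 : (n + m + 1) * (101 * (n + m + 1) ^ 3) = 101 * (n + m + 1) ^ 4 := by ring
  have h4 : n + m + 1 ≤ (n + m + 1) ^ 4 := Nat.le_self_pow (by norm_num) _
  simp only [fourPhase, steps_bind, steps_tick, Polynomial.eval_mul, Polynomial.eval_pow,
    Polynomial.eval_add, Polynomial.eval_X, Polynomial.eval_one, Polynomial.eval_ofNat]
  omega

end Steps

/-! ### Backlogs and trigger times -/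

section Surplus

open Filter Topology

variable {n m : ℕ} (K : Costs n) (σ : Fin m → Request n)

/-- The contribution of the request `p` to the backlog of `v` at time `t`. -/
noncomputable def overdueCost (v : Fin n) (t : ℝ) (p : Fin m) : ℝ :=
  if (σ p).item = v ∧ (σ p).deadline ≤ t then (σ p).cost t else 0

theorem cost_nonneg_of_deadline_le {p : Request n} {t : ℝ} (h : p.deadline ≤ t) : 0 ≤ p.cost t :=
  p.cost_nonneg t (p.arrival_le_deadline.trans h)

theorem overdueCost_nonneg (v : Fin n) (t : ℝ) (p : Fin m) : 0 ≤ overdueCost σ v t p := by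
  unfold overdueCost
  split_ifs with h
  · exact cost_nonneg_of_deadline_le h.2
  · exact le_rfl

theorem monotone_overdueCost (v : Fin n) (p : Fin m) : Monotone fun t => overdueCost σ v t p := by
  intro s t hst
  by_cases h : (σ p).item = v ∧ (σ p).deadline ≤ s
  · have h' : (σ p).item = v ∧ (σ p).deadline ≤ t := ⟨h.1, h.2.trans hst⟩
    simpa only [overdueCost, if_pos h, if_pos h'] using
      (σ p).backlog_monotone h.2 h'.2 hst
  · simpa only [overdueCost, if_neg h] using overdueCost_nonneg σ v t p

theorem continuousWithinAt_overdueCost (v : Fin n) (t : ℝ) (p : Fin m) :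
    ContinuousWithinAt (fun s => overdueCost σ v s p) (Set.Ici t) t := by
  by_cases hv : (σ p).item = v
  · by_cases hd : (σ p).deadline ≤ t
    · have h := ((σ p).backlog_continuous t hd).mono (Set.Ici_subset_Ici.2 hd)
      refine h.congr (fun s hs => ?_) ?_
      · rw [overdueCost, if_pos ⟨hv, hd.trans hs⟩]
      · rw [overdueCost, if_pos ⟨hv, hd⟩]
    · have h : (fun s => overdueCost σ v s p) =ᶠ[𝓝 t] fun _ => 0 := by
        filter_upwards [eventually_lt_nhds (not_le.1 hd)] with s hs
        rw [overdueCost, if_neg fun h => absurd h.2 (not_le.2 hs)]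
      exact (continuousAt_const.congr h.symm).continuousWithinAt
  · simp only [overdueCost, hv, false_and, if_false]
    exact continuousWithinAt_const

theorem backlog_eq_sum {U : List (Fin m)} (hU : U.Nodup) (v : Fin n) (t : ℝ) :
    backlog σ U v t = ∑ p ∈ U.toFinset, overdueCost σ v t p := by
  unfold backlog overdueCost
  rw [← List.sum_toFinset _ (hU.filter _), List.toFinset_filter, Finset.sum_filter]
  simp

theorem surplus_eq_sum (U : List (Fin m)) (t : ℝ) :
    surplus K σ U t = ∑ v, max (backlog σ U v t - K.item v) 0 := by
  unfold surplus
  refine Finset.sum_congr rfl fun v _ => ?_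
  split_ifs with h
  · rw [max_eq_left (sub_nonneg.2 h)]
  · rw [max_eq_right (sub_nonpos.2 (not_le.1 h).le)]

theorem continuousWithinAt_surplus {U : List (Fin m)} (hU : U.Nodup) (t : ℝ) :
    ContinuousWithinAt (surplus K σ U) (Set.Ici t) t := by
  have h : surplus K σ U =
      fun s => ∑ v, max ((∑ p ∈ U.toFinset, overdueCost σ v s p) - K.item v) 0 := by
    funext s
    simp only [surplus_eq_sum, backlog_eq_sum σ hU]
  rw [h]
  refine tendsto_finsetSum _ fun v _ => Tendsto.max (Tendsto.sub ?_ tendsto_const_nhds)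
    tendsto_const_nhds
  exact tendsto_finsetSum _ fun p _ => continuousWithinAt_overdueCost σ v t p

theorem surplus_mono {U U' : List (Fin m)} (hU : U.Nodup) (hU' : U'.Nodup) (h : U ⊆ U') {s t : ℝ}
    (hst : s ≤ t) : surplus K σ U s ≤ surplus K σ U' t := by
  simp only [surplus_eq_sum, backlog_eq_sum σ hU, backlog_eq_sum σ hU']
  refine Finset.sum_le_sum fun v _ => max_le_max (sub_le_sub_right ?_ _) le_rfl
  refine (Finset.sum_le_sum fun p _ => monotone_overdueCost σ v p hst).trans ?_
  exact Finset.sum_le_sum_of_subset_of_nonneg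
    (fun p hp => List.mem_toFinset.2 (h (List.mem_toFinset.1 hp)))
    fun p _ _ => overdueCost_nonneg σ v t p

/-- Before all deadlines no request is overdue. -/
theorem bddBelow_root_le_surplus {U : List (Fin m)} (hU : U.Nodup) :
    BddBelow {t | K.root ≤ surplus K σ U t} := by
  obtain ⟨B, hB⟩ := (Set.finite_range fun p => (σ p).deadline).bddBelow
  refine ⟨B, fun t ht => ?_⟩
  by_contra hlt
  have h0 : surplus K σ U t = 0 := by
    rw [surplus_eq_sum]
    refine Finset.sum_eq_zero fun v _ => max_eq_right ?_
    rw [backlog_eq_sum σ hU, Finset.sum_eq_zero, zero_sub, neg_nonpos]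
    · exact K.item_nonneg v
    · intro p _
      refine if_neg fun h => hlt ((hB ⟨p, rfl⟩).trans h.2)
  have ht : K.root ≤ surplus K σ U t := ht
  exact absurd (h0 ▸ ht) (not_le.2 K.root_pos)

/-- By right-continuity of the backlogs, the trigger time is attained. -/
theorem triggerTime_eq_some_iff {U : List (Fin m)} (hU : U.Nodup) (t : ℝ) :
    triggerTime K σ U = some t ↔ IsLeast {t | K.root ≤ surplus K σ U t} t := by
  have key : (∃ t, K.root ≤ surplus K σ U t) →
      IsLeast {t | K.root ≤ surplus K σ U t} (sInf {t | K.root ≤ surplus K σ U t}) := by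
    intro h
    have hb := bddBelow_root_le_surplus K σ hU
    have hg := isGLB_csInf (s := {t | K.root ≤ surplus K σ U t}) h hb
    refine ⟨?_, hg.1⟩
    by_contra hlt
    have h1 := (continuousWithinAt_surplus K σ hU _).eventually_lt_const (not_le.1 hlt)
    obtain ⟨x, hx1, hx2⟩ := (h1.and_frequently (hg.frequently_mem h)).exists
    exact absurd hx2 (not_le.2 hx1)
  unfold triggerTime
  split_ifs with h
  · rw [Option.some_inj]
    exact ⟨fun e => e ▸ key h, fun e => (key h).unique e⟩
  · simp only [false_iff]
    exact fun e => h ⟨t, e.1⟩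

theorem triggerTime_eq_none_iff (U : List (Fin m)) :
    triggerTime K σ U = none ↔ ∀ t, surplus K σ U t < K.root := by
  unfold triggerTime
  split_ifs with h
  · simpa using h
  · simpa using h

end Surplus

/-! ### The phases of a service split the list of unsatisfied requests -/

section Perm

open Timed

variable {n m : ℕ} (K : Costs n) (σ : Fin m → Request n)

theorem Timed.partition_perm {α : Type} (q : α → Timed Bool) (l : List α) :
    ((partition q l).val.1 ++ (partition q l).val.2).Perm l := by
  rw [val_partition]
  exact List.filter_append_perm _ l

theorem holdingPhase_perm (t c : ℝ) (I : List (Fin n)) (R : List (Fin m)) :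
    ((holdingPhase σ t c I R).val.1 ++ (holdingPhase σ t c I R).val.2).Perm R := by
  unfold holdingPhase
  simp only [val_bind, val_pure, val_append]
  rw [← List.append_assoc, takePrefix_append, val_sort]
  exact ((List.perm_insertionSort _ _).append_right _).trans (partition_perm _ R)

theorem localPhases_perm (t : ℝ) (I : List (Fin n)) (R : List (Fin m)) :
    ((localPhases K σ t I R).val.1 ++ (localPhases K σ t I R).val.2).Perm R := by
  induction I generalizing R with
  | nil => simp [localPhases]
  | cons v I ih =>
    simp only [localPhases, val_bind, val_pure, val_append, List.append_assoc]
    exact ((ih _).append_left _).trans (holdingPhase_perm σ t _ [v] R)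

/-- The requests satisfied by a service and the remaining ones. -/
theorem serve_perm (t : ℝ) (U : List (Fin m)) :
    ∃ q, (serve K σ t U).val.1.reqs = q.toFinset ∧ (q ++ (serve K σ t U).val.2).Perm U := by
  unfold serve
  simp only [val_bind, val_pure, val_append]
  set act := (partition (fun p => Timed.le (σ p).arrival t) U).val with hact
  set items := (partition (isMature K σ act.1 t) (List.finRange n)).val
  set b1 := (partition (overdueIn σ t items.1) act.1).val with hb1
  generalize (sort (Timed.matureHat K σ act.1 t) _).val = srt
  set chosen := (takePrefix (fun v => (pure (K.item v) : Timed ℝ)) (Timed.add K.root K.root).val 0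
    srt).val
  set b2 := (partition (overdueIn σ t chosen.1) b1.2).val with hb2
  set incl := items.1 ++ chosen.1
  set h1 := (localPhases K σ t incl b2.2).val with hh1
  set h2 := (holdingPhase σ t K.root incl h1.2).val with hh2
  refine ⟨_, rfl, ?_⟩
  simp only [List.append_assoc]
  have p0 := partition_perm (fun p => Timed.le (σ p).arrival t) U
  have p1 := partition_perm (overdueIn σ t items.1) act.1
  have p2 := partition_perm (overdueIn σ t chosen.1) b1.2
  have p3 := localPhases_perm K σ t incl b2.2
  have p4 := holdingPhase_perm σ t K.root incl h1.2
  rw [← hact] at p0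
  rw [← hb1] at p1
  rw [← hb2] at p2
  rw [← hh1] at p3
  rw [← hh2] at p4
  refine List.Perm.trans ?_ (((p1.symm.trans ((p2.symm.trans ((p3.symm.trans
    (p4.symm.append_left _)).append_left _)).append_left _)).symm.append_right act.2).trans p0)
  simp only [List.append_assoc]
  exact List.Perm.refl _

end Perm

/-! ### Virtual deadlines and maturity times as thresholds -/

section Thresholds

open Filter Topology

variable {n m : ℕ} (K : Costs n) (σ : Fin m → Request n)

/-- If a property persists once it holds on `S`, and its failure is stable to the right, then it
holds from the infimum of `S` on. -/
theorem of_sInf_coe_le {S : Set ℝ} {Q : ℝ → Prop} {x : ℝ} (hS : ∀ s ∈ S, ∀ y, s ≤ y → Q y)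
    (hQ : ¬ Q x → ∀ᶠ y in 𝓝[≥] x, ¬ Q y) (h : sInf ((fun s : ℝ => (s : EReal)) '' S) ≤ x) :
    Q x := by
  by_contra hx
  obtain ⟨ε, hε, hy⟩ := (mem_nhdsGE_iff_exists_Ico_subset).1 (hQ hx)
  obtain ⟨_, ⟨s, hs, rfl⟩, hlt⟩ := sInf_lt_iff.1 (h.trans_lt (EReal.coe_lt_coe_iff.2 hε))
  rcases le_or_gt s x with hsx | hsx
  · exact hx (hS s hs x hsx)
  · exact hy ⟨hsx.le, EReal.coe_lt_coe_iff.1 hlt⟩ (hS s hs s le_rfl)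

/-- The virtual deadline is reached once the backlog cost is at least the cost at time `t`. -/
theorem virtualDeadline_le_iff {p : Request n} {t x : ℝ} (ha : p.arrival ≤ t)
    (hd : t < p.deadline) :
    virtualDeadline p t ≤ x ↔ p.deadline ≤ x ∧ p.cost t ≤ p.cost x := by
  constructor
  · refine of_sInf_coe_le (Q := fun x => p.deadline ≤ x ∧ p.cost t ≤ p.cost x) ?_ ?_
    · rintro s ⟨hs, hc⟩ y hy
      exact ⟨hs.trans hy, hc ▸ p.backlog_monotone hs (hs.trans hy) hy⟩
    · intro h
      by_cases hx : p.deadline ≤ x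
      · have hc : p.cost x < p.cost t := by
          by_contra hc
          exact h ⟨hx, not_lt.1 hc⟩
        have hcont := (p.backlog_continuous x hx).mono (Set.Ici_subset_Ici.2 hx)
        filter_upwards [hcont.eventually_lt_const hc] with y hy hy'
        exact absurd hy'.2 (not_le.2 hy)
      · filter_upwards [nhdsWithin_le_nhds (eventually_lt_nhds (not_le.1 hx))] with y hy hy'
        exact absurd hy'.1 (not_le.2 hy)
  · rintro ⟨hx, hc⟩
    have hdt : p.cost p.deadline ≤ p.cost t :=
      p.holding_antitone ⟨ha, hd.le⟩ ⟨p.arrival_le_deadline, le_rfl⟩ hd.le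
    obtain ⟨s, hs, hcs⟩ := intermediate_value_Icc hx
      (p.backlog_continuous.mono Set.Icc_subset_Ici_self) ⟨hdt, hc⟩
    have hmem : s ∈ {s | p.deadline ≤ s ∧ p.cost s = p.cost t} := ⟨hs.1, hcs⟩
    exact (sInf_le (Set.mem_image_of_mem _ hmem)).trans (EReal.coe_le_coe_iff.2 hs.2)

/-- The requests for `v` among `A` that count towards its maturity at time `x` as predicted at
time `t`: those whose deadline, or virtual deadline with respect to `t`, is reached. -/
noncomputable def pressing (A : Finset (Fin m)) (t : ℝ) (v : Fin n) (x : ℝ) : Finset (Fin m) :=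
  A.filter fun p => (σ p).item = v ∧ (σ p).deadline ≤ x ∧
    (t < (σ p).deadline → (σ p).cost t ≤ (σ p).cost x)

/-- At time `t` the item `v` is predicted to be mature by time `x`. -/
def MatureBy (A : Finset (Fin m)) (t : ℝ) (v : Fin n) (x : ℝ) : Prop :=
  K.item v ≤ ∑ p ∈ pressing σ A t v x, (σ p).cost x

theorem matureBy_mono {A : Finset (Fin m)} {t : ℝ} {v : Fin n} {x y : ℝ} (hxy : x ≤ y)
    (h : MatureBy K σ A t v x) : MatureBy K σ A t v y := by
  unfold MatureBy at h ⊢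
  refine h.trans ((Finset.sum_le_sum (g := fun p => (σ p).cost y) fun p hp => ?_).trans
    (Finset.sum_le_sum_of_subset_of_nonneg (fun p hp => ?_) fun p hp _ => ?_))
  · obtain ⟨-, -, hd, -⟩ := Finset.mem_filter.1 hp
    exact (σ p).backlog_monotone hd (hd.trans hxy) hxy
  · obtain ⟨hA, hv, hd, hc⟩ := Finset.mem_filter.1 hp
    exact Finset.mem_filter.2 ⟨hA, hv, hd.trans hxy, fun ht =>
      (hc ht).trans ((σ p).backlog_monotone hd (hd.trans hxy) hxy)⟩
  · obtain ⟨-, -, hd, -⟩ := Finset.mem_filter.1 hp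
    exact cost_nonneg_of_deadline_le hd

/-- The predicted backlog is right-continuous, so its threshold is not reached right after a time
at which it is not reached. -/
theorem eventually_not_matureBy {A : Finset (Fin m)} {t : ℝ} {v : Fin n} {x : ℝ}
    (h : ¬ MatureBy K σ A t v x) : ∀ᶠ y in 𝓝[≥] x, ¬ MatureBy K σ A t v y := by
  have key : ContinuousWithinAt (fun y => ∑ p ∈ pressing σ A t v y, (σ p).cost y)
      (Set.Ici x) x := by
    unfold pressing
    simp only [Finset.sum_filter]
    refine tendsto_finsetSum _ fun p _ => ?_
    by_cases hx : (σ p).item = v ∧ (σ p).deadline ≤ x ∧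
      (t < (σ p).deadline → (σ p).cost t ≤ (σ p).cost x)
    · have hc := ((σ p).backlog_continuous x hx.2.1).mono (Set.Ici_subset_Ici.2 hx.2.1)
      refine ContinuousWithinAt.congr (f := (σ p).cost) hc (fun y hy => ?_) (if_pos hx)
      exact if_pos ⟨hx.1, hx.2.1.trans hy, fun ht => (hx.2.2 ht).trans
        ((σ p).backlog_monotone hx.2.1 (hx.2.1.trans hy) hy)⟩
    · have h0 : ∀ᶠ y in 𝓝[≥] x, ¬ ((σ p).item = v ∧ (σ p).deadline ≤ y ∧
          (t < (σ p).deadline → (σ p).cost t ≤ (σ p).cost y)) := by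
        by_cases hv : (σ p).item = v
        · by_cases hd : (σ p).deadline ≤ x
          · have ht : t < (σ p).deadline := by
              by_contra ht
              exact hx ⟨hv, hd, fun h => absurd h ht⟩
            have hlt : (σ p).cost x < (σ p).cost t := by
              by_contra hc
              exact hx ⟨hv, hd, fun _ => not_lt.1 hc⟩
            have hcont := ((σ p).backlog_continuous x hd).mono (Set.Ici_subset_Ici.2 hd)
            filter_upwards [hcont.eventually_lt_const hlt] with y hy hy'
            exact absurd (hy'.2.2 ht) (not_le.2 hy)
          · filter_upwards [nhdsWithin_le_nhds (eventually_lt_nhds (not_le.1 hd))] with y hy hy'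
            exact absurd hy'.2.1 (not_le.2 hy)
        · exact Eventually.of_forall fun y hy => hv hy.1
      rw [if_neg hx]
      refine Tendsto.congr' (f₁ := fun _ => (0 : ℝ)) ?_ tendsto_const_nhds
      filter_upwards [h0] with y hy
      exact (if_neg hy).symm
  filter_upwards [key.eventually_lt_const (not_le.1 h)] with y hy
  exact not_le.2 hy

theorem matureHat_le_iff {A : List (Fin m)} (hA : A.Nodup) {t x : ℝ} (htx : t ≤ x) (v : Fin n) :
    matureHat K σ A t v ≤ x ↔ MatureBy K σ A.toFinset t v x := by
  have key : ∀ s, t ≤ s → (((A.filter fun p => decide ((σ p).item = v ∧ (σ p).deadline ≤ t)).map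
      fun p => (σ p).cost s).sum + ((A.filter fun p => decide ((σ p).item = v ∧
        t < (σ p).deadline ∧ (σ p).deadline ≤ s ∧ (σ p).cost t ≤ (σ p).cost s)).map
          fun p => (σ p).cost s).sum) = ∑ p ∈ pressing σ A.toFinset t v s, (σ p).cost s := by
    intro s hs
    rw [← List.sum_toFinset _ (hA.filter _), ← List.sum_toFinset _ (hA.filter _),
      ← Finset.sum_union]
    · refine Finset.sum_congr ?_ fun _ _ => rfl
      ext p
      simp only [pressing, Finset.mem_union, List.mem_toFinset, List.mem_filter,
        decide_eq_true_eq, Finset.mem_filter]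
      constructor
      · rintro (⟨h1, h2, h3⟩ | ⟨h1, h2, h3, h4, h5⟩)
        · exact ⟨h1, h2, h3.trans hs, fun h => absurd h (not_lt.2 h3)⟩
        · exact ⟨h1, h2, h4, fun _ => h5⟩
      · rintro ⟨h1, h2, h3, h4⟩
        rcases le_or_gt (σ p).deadline t with h | h
        · exact Or.inl ⟨h1, h2, h⟩
        · exact Or.inr ⟨h1, h2, h, h3, h4 h⟩
    · rw [Finset.disjoint_left]
      intro p hp hp'
      simp only [List.mem_toFinset, List.mem_filter, decide_eq_true_eq] at hp hp'
      exact absurd hp'.2.2.1 (not_lt.2 hp.2.2)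
  constructor
  · refine of_sInf_coe_le (Q := MatureBy K σ A.toFinset t v) ?_ (eventually_not_matureBy K σ)
    rintro s ⟨hts, hs⟩ y hy
    rw [key s hts] at hs
    exact matureBy_mono K σ hy hs
  · intro h
    refine sInf_le ⟨x, ⟨htx, ?_⟩, rfl⟩
    rw [key x htx]
    exact h

end Thresholds

/-! ### The holding phases -/

section Holding

open Timed

variable {n m : ℕ} (K : Costs n) (σ : Fin m → Request n)

/-- What is known about a request `p` that a service at time `τ` leaves unsatisfied, where `T` is
the set of requests chosen in a holding phase with cost bound `c` for which `p` was eligible. If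
`p` was active, it is not overdue at time `τ`, and if its cost is at most `c`, then `T` has cost
more than `c`, and its virtual deadlines are not later than the one of `p`. -/
def Deferred (τ c : ℝ) (T : Finset (Fin m)) (p : Fin m) : Prop :=
  (σ p).arrival ≤ τ → τ < (σ p).deadline ∧ ((σ p).cost τ ≤ c →
    c < ∑ q ∈ T, (σ q).cost τ ∧ ∀ q ∈ T, (σ q).arrival ≤ τ ∧ τ < (σ q).deadline ∧
      ∀ x, (σ p).deadline ≤ x → (σ p).cost τ ≤ (σ p).cost x →
        (σ q).deadline ≤ x ∧ (σ q).cost τ ≤ (σ q).cost x)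

theorem holdingPhase_spec {t c : ℝ} (hc : 0 ≤ c) {I : List (Fin n)} {R : List (Fin m)}
    (hR : R.Nodup)
    (hA : ∀ p ∈ R, (σ p).item ∈ I → (σ p).arrival ≤ t ∧ t < (σ p).deadline) :
    (∀ p ∈ (holdingPhase σ t c I R).val.1, p ∈ R ∧ (σ p).item ∈ I) ∧
    (∑ p ∈ (holdingPhase σ t c I R).val.1.toFinset, (σ p).cost t ≤ 2 * c) ∧
    ∀ p ∈ R, (σ p).item ∈ I → p ∉ (holdingPhase σ t c I R).val.1 →
      Deferred σ t c (holdingPhase σ t c I R).val.1.toFinset p := by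
  have hnd : (holdingPhase σ t c I R).val.1.Nodup :=
    (List.nodup_append.1 ((holdingPhase_perm σ t c I R).nodup_iff.2 hR)).1
  revert hnd
  unfold holdingPhase
  simp only [val_bind, val_pure, val_append, val_add]
  set q : Fin m → Timed Bool := fun p => do
      let i ← itemIn σ I p
      if i then do
        let x ← evalCost (σ p) t
        Timed.le x c
      else pure false with hq
  have hqv : ∀ p, (q p).val = decide ((σ p).item ∈ I ∧ (σ p).cost t ≤ c) := by
    intro p
    by_cases h : (σ p).item ∈ I <;> simp [hq, h]
  set srt := (sort (fun p => Timed.virtualDeadline (σ p) t) (partition q R).val.1).val with hsrt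
  have hmem : ∀ p, p ∈ srt ↔ p ∈ R ∧ (σ p).item ∈ I ∧ (σ p).cost t ≤ c := by
    intro p
    rw [hsrt, val_sort, List.mem_insertionSort, val_partition]
    simp [hqv]
  have hsorted : srt.Pairwise fun a b => virtualDeadline (σ a) t ≤ virtualDeadline (σ b) t := by
    rw [hsrt, val_sort]
    exact List.pairwise_insertionSort
      (fun a b => virtualDeadline (σ a) t ≤ virtualDeadline (σ b) t) _
  have happ := takePrefix_append (fun p => evalCost (σ p) t) (c + c) 0 srt
  have hsum := takePrefix_sum_le (fun p => evalCost (σ p) t) (c + c) 0 srt (by linarith)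
  have hlt := lt_takePrefix_sum (fun p => evalCost (σ p) t) (c + c) 0 srt
  generalize (takePrefix (fun p => evalCost (σ p) t) (c + c) 0 srt).val = r at happ hsum hlt ⊢
  intro hnd
  simp only [val_evalCost, zero_add] at hsum hlt
  rw [← List.sum_toFinset _ hnd] at hsum hlt
  have h1 : ∀ p ∈ r.1, p ∈ srt := fun p hp => happ ▸ List.mem_append_left _ hp
  refine ⟨fun p hp => ⟨((hmem p).1 (h1 p hp)).1, ((hmem p).1 (h1 p hp)).2.1⟩, by linarith, ?_⟩
  intro p hp hpI hpr _
  have hpA := hA p hp hpI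
  refine ⟨hpA.2, fun hpc => ?_⟩
  have hp2 : p ∈ r.2 := by
    have : p ∈ r.1 ++ r.2 := happ ▸ (hmem p).2 ⟨hp, hpI, hpc⟩
    exact (List.mem_append.1 this).resolve_left hpr
  constructor
  · obtain ⟨b, l, hbl⟩ := List.exists_cons_of_ne_nil (List.ne_nil_of_mem hp2)
    have hb : b ∈ srt := happ ▸ List.mem_append_right _ (hbl ▸ List.mem_cons_self)
    have := hlt b l hbl
    have := ((hmem b).1 hb).2.2
    linarith
  · intro q hq
    have hqs := (hmem q).1 (h1 q (List.mem_toFinset.1 hq))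
    have hqA := hA q hqs.1 hqs.2.1
    refine ⟨hqA.1, hqA.2, fun x hx hcx => ?_⟩
    rw [← happ] at hsorted
    have hle := (List.pairwise_append.1 hsorted).2.2 q (List.mem_toFinset.1 hq) p hp2
    exact (virtualDeadline_le_iff hqA.1 hqA.2).1
      (hle.trans ((virtualDeadline_le_iff hpA.1 hpA.2).2 ⟨hx, hcx⟩))

theorem localPhases_spec {t : ℝ} {I : List (Fin n)} (hI : I.Nodup) {R : List (Fin m)}
    (hR : R.Nodup)
    (hA : ∀ p ∈ R, (σ p).item ∈ I → (σ p).arrival ≤ t ∧ t < (σ p).deadline) :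
    (∀ p ∈ (localPhases K σ t I R).val.1, p ∈ R ∧ (σ p).item ∈ I) ∧
    (∀ v ∈ I, ∑ p ∈ (localPhases K σ t I R).val.1.toFinset with (σ p).item = v,
      (σ p).cost t ≤ 2 * K.item v) ∧
    ∀ p ∈ R, (σ p).item ∈ I → p ∉ (localPhases K σ t I R).val.1 →
      Deferred σ t (K.item (σ p).item)
        ((localPhases K σ t I R).val.1.toFinset.filter fun q => (σ q).item = (σ p).item) p := by
  induction I generalizing R with
  | nil => simp [localPhases]
  | cons v I ih =>
    obtain ⟨hvI, hI'⟩ := List.nodup_cons.1 hI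
    have hperm := holdingPhase_perm σ t (K.item v) [v] R
    have hnd := List.nodup_append.1 (hperm.nodup_iff.2 hR)
    obtain ⟨h1, h2, h3⟩ := holdingPhase_spec σ (K.item_nonneg v) (I := [v]) hR (fun p hp hpv =>
      hA p hp (List.mem_cons.2 (Or.inl (List.mem_singleton.1 hpv))))
    simp only [localPhases, val_bind, val_pure, val_append]
    generalize (holdingPhase σ t (K.item v) [v] R).val = r at *
    have hsub : ∀ p ∈ r.2, p ∈ R := fun p hp => hperm.subset (List.mem_append_right _ hp)
    obtain ⟨g1, g2, g3⟩ := ih hI' hnd.2.1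
      (fun p hp hpI => hA p (hsub p hp) (List.mem_cons_of_mem _ hpI))
    generalize (localPhases K σ t I r.2).val = r' at *
    have e1 : ((r.1 ++ r'.1).toFinset.filter fun q => (σ q).item = v) = r.1.toFinset := by
      ext p
      simp only [Finset.mem_filter, List.mem_toFinset, List.mem_append]
      constructor
      · rintro ⟨hp | hp, hv⟩
        · exact hp
        · exact absurd (hv ▸ (g1 p hp).2) hvI
      · exact fun hp => ⟨Or.inl hp, List.mem_singleton.1 (h1 p hp).2⟩
    have e2 : ∀ w ∈ I, ((r.1 ++ r'.1).toFinset.filter fun q => (σ q).item = w) =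
        r'.1.toFinset.filter fun q => (σ q).item = w := by
      intro w hw
      ext p
      simp only [Finset.mem_filter, List.mem_toFinset, List.mem_append]
      constructor
      · rintro ⟨hp | hp, hv⟩
        · have := List.mem_singleton.1 (h1 p hp).2
          exact absurd (this ▸ hv ▸ hw) hvI
        · exact ⟨hp, hv⟩
      · exact fun hp => ⟨Or.inr hp.1, hp.2⟩
    refine ⟨fun p hp => ?_, fun w hw => ?_, fun p hp hpI hpn => ?_⟩
    · rcases List.mem_append.1 hp with hp | hp
      · exact ⟨(h1 p hp).1, by simp [List.mem_singleton.1 (h1 p hp).2]⟩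
      · exact ⟨hsub p (g1 p hp).1, List.mem_cons_of_mem _ (g1 p hp).2⟩
    · rcases List.mem_cons.1 hw with rfl | hw
      · rw [e1]
        exact h2
      · rw [e2 w hw]
        exact g2 w hw
    · have hpn' := not_or.1 (fun h => hpn (List.mem_append.2 h))
      rcases List.mem_cons.1 hpI with hv | hv
      · rw [hv, e1]
        exact h3 p hp (List.mem_singleton.2 hv) hpn'.1
      · rw [e2 _ hv]
        refine g3 p ?_ hv hpn'.2
        exact (List.mem_append.1 (hperm.symm.subset hp)).resolve_left hpn'.1

end Holding

/-! ### Rounds of the algorithm -/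

section Rounds

open Timed

variable {n m : ℕ}

/-- A service of the algorithm, split into its phases. -/
structure Round (n m : ℕ) where
  /-- The time of the service. -/
  time : ℝ
  /-- The requests that are unsatisfied before the service, including those yet to arrive. -/
  pending : Finset (Fin m)
  /-- The mature items. -/
  mature : Finset (Fin n)
  /-- The premature items that are included. -/
  premature : Finset (Fin n)
  /-- The requests satisfied in the local holding phase. -/
  localReqs : Finset (Fin m)
  /-- The requests satisfied in the global holding phase. -/
  globalReqs : Finset (Fin m)

namespace Round

variable (K : Costs n) (σ : Fin m → Request n) (R : Round n m)

/-- The items of the service. -/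
def included : Finset (Fin n) := R.mature ∪ R.premature

/-- The active requests. -/
noncomputable def active : Finset (Fin m) := R.pending.filter fun p => (σ p).arrival ≤ R.time

/-- The overdue requests for the items in `I`. -/
noncomputable def overdue (I : Finset (Fin n)) : Finset (Fin m) :=
  R.pending.filter fun p => (σ p).deadline ≤ R.time ∧ (σ p).item ∈ I

/-- The requests satisfied in the local holding phase of the item `v`. -/
def localOf (v : Fin n) : Finset (Fin m) := R.localReqs.filter fun p => (σ p).item = v

/-- All requests satisfied by the service. -/
noncomputable def served : Finset (Fin m) :=
  R.overdue σ R.included ∪ (R.localReqs ∪ R.globalReqs)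

/-- The service without its division into phases. -/
noncomputable def toService : Service n m := ⟨R.time, R.included, R.served σ⟩

/-- The round follows the four phases of the algorithm. -/
structure FollowsPhases : Prop where
  mem_mature : ∀ v, v ∈ R.mature ↔ K.item v ≤ ∑ p ∈ R.overdue σ {v}, (σ p).cost R.time
  disjoint : Disjoint R.mature R.premature
  sum_premature : ∑ v ∈ R.premature, K.item v ≤ 2 * K.root
  /-- If an item with an active request is left out, then there is an item `w` for which the
  premature backlog phase stops. -/
  left_out : ∀ v ∉ R.included, (∃ p ∈ R.active σ, (σ p).item = v) →
    ∃ w ∉ R.included, 2 * K.root < ∑ u ∈ R.premature, K.item u + K.item w ∧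
      ∀ x, R.time ≤ x → MatureBy K σ (R.active σ) R.time v x →
        (∀ u ∈ R.premature, MatureBy K σ (R.active σ) R.time u x) ∧
          MatureBy K σ (R.active σ) R.time w x
  mem_local : ∀ p ∈ R.localReqs, p ∈ R.pending ∧ (σ p).arrival ≤ R.time ∧
    R.time < (σ p).deadline ∧ (σ p).item ∈ R.included
  sum_local : ∀ v ∈ R.included, ∑ p ∈ R.localOf σ v, (σ p).cost R.time ≤ 2 * K.item v
  local_deferred : ∀ p ∈ R.pending, (σ p).item ∈ R.included → R.time < (σ p).deadline →
    p ∉ R.localReqs → Deferred σ R.time (K.item (σ p).item) (R.localOf σ (σ p).item) p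
  mem_global : ∀ p ∈ R.globalReqs, p ∈ R.pending ∧ (σ p).arrival ≤ R.time ∧
    R.time < (σ p).deadline ∧ (σ p).item ∈ R.included ∧ p ∉ R.localReqs
  sum_global : ∑ p ∈ R.globalReqs, (σ p).cost R.time ≤ 2 * K.root
  global_deferred : ∀ p ∈ R.pending, (σ p).item ∈ R.included → R.time < (σ p).deadline →
    p ∉ R.localReqs → p ∉ R.globalReqs → Deferred σ R.time K.root R.globalReqs p

end Round

variable (K : Costs n) (σ : Fin m → Request n)

@[simp] theorem val_isMature (A : List (Fin m)) (t : ℝ) (v : Fin n) :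
    (isMature K σ A t v).val = decide (K.item v ≤ backlog σ A v t) := by
  simp only [isMature, val_bind, val_partition, val_sum, val_overdueIn, val_evalCost, val_le,
    List.mem_singleton, backlog]
  simp only [and_comm]
  congr!

/-- The rounds of the algorithm follow the four phases as they are described for sets. -/
theorem exists_round (t : ℝ) {U : List (Fin m)} (hU : U.Nodup) :
    ∃ R : Round n m, R.time = t ∧ R.pending = U.toFinset ∧ R.FollowsPhases K σ ∧
      (serve K σ t U).val.1 = R.toService σ ∧
      (serve K σ t U).val.2.Nodup ∧
      (serve K σ t U).val.2.toFinset = R.pending \ R.served σ := by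
  obtain ⟨q, hq, hperm⟩ := serve_perm K σ t U
  have hnd := List.nodup_append.1 (hperm.nodup_iff.2 hU)
  have hrest : (serve K σ t U).val.2.toFinset = U.toFinset \ (serve K σ t U).val.1.reqs := by
    rw [hq]
    ext p
    simp only [List.mem_toFinset, Finset.mem_sdiff, ← hperm.mem_iff, List.mem_append]
    constructor
    · exact fun hp => ⟨Or.inr hp, fun hpq => hnd.2.2 p hpq p hp rfl⟩
    · rintro ⟨hp | hp, hpn⟩
      · exact absurd hp hpn
      · exact hp
  suffices h : ∃ R : Round n m, R.time = t ∧ R.pending = U.toFinset ∧ R.FollowsPhases K σ ∧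
      (serve K σ t U).val.1 = R.toService σ by
    obtain ⟨R, h1, h2, h3, h4⟩ := h
    refine ⟨R, h1, h2, h3, h4, hnd.2.1, ?_⟩
    rw [hrest, h2, h4]
    rfl
  clear hq hperm hnd hrest q
  unfold serve
  simp only [val_bind, val_pure, val_append, val_add]
  set act := (partition (fun p => Timed.le (σ p).arrival t) U).val with hact
  have hact1 : ∀ p, p ∈ act.1 ↔ p ∈ U ∧ (σ p).arrival ≤ t := by
    intro p
    simp [hact]
  have hactnd : act.1.Nodup := by
    rw [hact, val_partition]
    exact hU.filter _
  set items := (partition (isMature K σ act.1 t) (List.finRange n)).val with hitems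
  have hitems1 : ∀ v, v ∈ items.1 ↔ K.item v ≤ backlog σ act.1 v t := by
    intro v
    simp [hitems]
  have hitems2 : ∀ v, v ∈ items.2 ↔ v ∉ items.1 := by
    intro v
    simp [hitems]
  have hitemsnd : items.1.Nodup ∧ items.2.Nodup := by
    rw [hitems, val_partition]
    exact ⟨(List.nodup_finRange n).filter _, (List.nodup_finRange n).filter _⟩
  set b1 := (partition (overdueIn σ t items.1) act.1).val with hb1
  have hb11 : ∀ p, p ∈ b1.1 ↔ p ∈ act.1 ∧ (σ p).deadline ≤ t ∧ (σ p).item ∈ items.1 := by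
    intro p
    simp [hb1]
  have hb12 : ∀ p, p ∈ b1.2 ↔ p ∈ act.1 ∧ ¬ ((σ p).deadline ≤ t ∧ (σ p).item ∈ items.1) := by
    intro p
    rw [hb1, val_partition, List.mem_filter, val_overdueIn, Bool.not_eq_true',
      decide_eq_false_iff_not]
  have hb1nd : b1.2.Nodup := by
    rw [hb1, val_partition]
    exact hactnd.filter _
  set prem := (partition (fun v => any (fun p => sameItem v (σ p).item) act.1) items.2).val
    with hprem
  set srt := (sort (Timed.matureHat K σ act.1 t) prem.1).val with hsrt
  have hsrt1 : ∀ v, v ∈ srt ↔ v ∉ items.1 ∧ ∃ p ∈ act.1, (σ p).item = v := by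
    intro v
    rw [hsrt, val_sort, List.mem_insertionSort, hprem, val_partition, List.mem_filter, hitems2,
      val_any, List.any_eq_true]
    simp only [val_sameItem, decide_eq_true_eq, @eq_comm _ v]
  have hsrtnd : srt.Nodup := by
    rw [hsrt, val_sort, (List.perm_insertionSort _ _).nodup_iff, hprem, val_partition]
    exact hitemsnd.2.filter _
  have hsorted : srt.Pairwise fun a b =>
      JRP.matureHat K σ act.1 t a ≤ JRP.matureHat K σ act.1 t b := by
    rw [hsrt, val_sort]
    exact List.pairwise_insertionSort (fun a b =>
      JRP.matureHat K σ act.1 t a ≤ JRP.matureHat K σ act.1 t b) _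
  have happ := takePrefix_append (fun v => (pure (K.item v) : Timed ℝ)) (K.root + K.root) 0 srt
  have hsum := takePrefix_sum_le (fun v => (pure (K.item v) : Timed ℝ)) (K.root + K.root) 0 srt
    (by linarith [K.root_pos])
  have hlt := lt_takePrefix_sum (fun v => (pure (K.item v) : Timed ℝ)) (K.root + K.root) 0 srt
  generalize (takePrefix (fun v => (pure (K.item v) : Timed ℝ)) (K.root + K.root) 0 srt).val
    = chosen at happ hsum hlt ⊢
  have hchnd := List.nodup_append.1 (happ ▸ hsrtnd)
  simp only [val_pure, zero_add] at hsum hlt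
  rw [← List.sum_toFinset _ hchnd.1] at hsum hlt
  have hch : ∀ v ∈ chosen.1, v ∉ items.1 := fun v hv =>
    ((hsrt1 v).1 (happ ▸ List.mem_append_left _ hv)).1
  set b2 := (partition (overdueIn σ t chosen.1) b1.2).val with hb2
  have hb21 : ∀ p, p ∈ b2.1 ↔ p ∈ b1.2 ∧ (σ p).deadline ≤ t ∧ (σ p).item ∈ chosen.1 := by
    intro p
    simp [hb2]
  have hb22 : ∀ p, p ∈ b2.2 ↔ p ∈ b1.2 ∧ ¬ ((σ p).deadline ≤ t ∧ (σ p).item ∈ chosen.1) := by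
    intro p
    rw [hb2, val_partition, List.mem_filter, val_overdueIn, Bool.not_eq_true',
      decide_eq_false_iff_not]
  have hb2nd : b2.2.Nodup := by
    rw [hb2, val_partition]
    exact hb1nd.filter _
  have hinclnd : (items.1 ++ chosen.1).Nodup := List.nodup_append.2
    ⟨hitemsnd.1, hchnd.1, fun a ha b hb hab => hch b hb (hab ▸ ha)⟩
  have hA : ∀ p ∈ b2.2, (σ p).item ∈ items.1 ++ chosen.1 →
      (σ p).arrival ≤ t ∧ t < (σ p).deadline := by
    intro p hp hpI
    have h2 := (hb22 p).1 hp
    have h1 := (hb12 p).1 h2.1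
    refine ⟨((hact1 p).1 h1.1).2, ?_⟩
    by_contra hd
    rcases List.mem_append.1 hpI with h | h
    · exact h1.2 ⟨not_lt.1 hd, h⟩
    · exact h2.2 ⟨not_lt.1 hd, h⟩
  obtain ⟨l1, l2, l3⟩ := localPhases_spec K σ hinclnd hb2nd hA
  have lperm := localPhases_perm K σ t (items.1 ++ chosen.1) b2.2
  generalize (localPhases K σ t (items.1 ++ chosen.1) b2.2).val = h1 at *
  have lnd := List.nodup_append.1 (lperm.nodup_iff.2 hb2nd)
  have h1sub : ∀ p ∈ h1.2, p ∈ b2.2 := fun p hp => lperm.subset (List.mem_append_right _ hp)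
  obtain ⟨g1, g2, g3⟩ := holdingPhase_spec σ K.root_pos.le (I := items.1 ++ chosen.1) lnd.2.1
    (fun p hp hpI => hA p (h1sub p hp) hpI)
  generalize (holdingPhase σ t K.root (items.1 ++ chosen.1) h1.2).val = h2 at *
  have hincl : ∀ v, v ∈ items.1.toFinset ∪ chosen.1.toFinset ↔ v ∈ items.1 ++ chosen.1 := by
    intro v
    simp
  have hactF : (U.toFinset.filter fun p => (σ p).arrival ≤ t) = act.1.toFinset := by
    ext p
    simp [hact1]
  -- pending active requests for included items that are not overdue reach the holding phases
  have hreach : ∀ p ∈ U.toFinset, t < (σ p).deadline → (σ p).arrival ≤ t → p ∈ b2.2 := by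
    intro p hp hd ha
    exact (hb22 p).2 ⟨(hb12 p).2 ⟨(hact1 p).2 ⟨List.mem_toFinset.1 hp, ha⟩,
      fun h => absurd h.1 (not_le.2 hd)⟩, fun h => absurd h.1 (not_le.2 hd)⟩
  have hfrom : ∀ p ∈ b2.2, p ∈ U.toFinset := fun p hp =>
    List.mem_toFinset.2 ((hact1 p).1 ((hb12 p).1 ((hb22 p).1 hp).1).1).1
  refine ⟨⟨t, U.toFinset, items.1.toFinset, chosen.1.toFinset, h1.1.toFinset, h2.1.toFinset⟩,
    rfl, rfl, ?_, ?_⟩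
  · constructor
    · intro v
      rw [List.mem_toFinset, hitems1, backlog, ← List.sum_toFinset _ (hactnd.filter _)]
      suffices h : (act.1.filter fun p => decide ((σ p).item = v ∧ (σ p).deadline ≤ t)).toFinset =
          U.toFinset.filter fun p => (σ p).deadline ≤ t ∧ (σ p).item ∈ ({v} : Finset (Fin n)) by
        rw [h]
        rfl
      ext p
      simp only [List.mem_toFinset, List.mem_filter, hact1, decide_eq_true_eq, Finset.mem_filter,
        Finset.mem_singleton]
      constructor
      · rintro ⟨⟨h1, -⟩, h2, h3⟩
        exact ⟨h1, h3, h2⟩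
      · rintro ⟨h1, h2, h3⟩
        exact ⟨⟨h1, (σ p).arrival_le_deadline.trans h2⟩, h3, h2⟩
    · rw [Finset.disjoint_left]
      intro v hv hv'
      exact hch v (List.mem_toFinset.1 hv') (List.mem_toFinset.1 hv)
    · simpa [two_mul] using hsum
    · rintro v hv ⟨p, hp, hpv⟩
      have hv' := fun h => hv ((hincl v).2 h)
      have hpa : p ∈ act.1 := List.mem_toFinset.1 (hactF ▸ hp)
      have hvs : v ∈ srt := (hsrt1 v).2
        ⟨fun h => hv' (List.mem_append_left _ h), p, hpa, hpv⟩
      have hv2 : v ∈ chosen.2 := by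
        rw [← happ] at hvs
        exact (List.mem_append.1 hvs).resolve_left fun h => hv' (List.mem_append_right _ h)
      obtain ⟨w, l, hwl⟩ := List.exists_cons_of_ne_nil (List.ne_nil_of_mem hv2)
      have hw2 : w ∈ chosen.2 := hwl ▸ List.mem_cons_self
      have hws : w ∈ srt := happ ▸ List.mem_append_right _ hw2
      refine ⟨w, fun h => ?_, ?_, fun x hx hmx => ?_⟩
      · rcases List.mem_append.1 ((hincl w).1 h) with h | h
        · exact ((hsrt1 w).1 hws).1 h
        · exact hchnd.2.2 w h w hw2 rfl
      · have := hlt w l hwl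
        rw [two_mul]
        exact this
      · have hmx' : JRP.matureHat K σ act.1 t v ≤ x :=
          (matureHat_le_iff K σ hactnd hx v).2 (hactF ▸ hmx)
        rw [← happ] at hsorted
        have hs := List.pairwise_append.1 hsorted
        have key : ∀ u, JRP.matureHat K σ act.1 t u ≤ JRP.matureHat K σ act.1 t v →
            MatureBy K σ (U.toFinset.filter fun p => (σ p).arrival ≤ t) t u x := by
          intro u hu
          rw [hactF]
          exact (matureHat_le_iff K σ hactnd hx u).1 (hu.trans hmx')
        refine ⟨fun u hu => key u (hs.2.2 u (List.mem_toFinset.1 hu) v hv2), key w ?_⟩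
        have hs2 := hs.2.1
        rw [hwl] at hs2 hv2
        rcases List.mem_cons.1 hv2 with h | h
        · rw [h]
        · exact (List.pairwise_cons.1 hs2).1 v h
    · intro p hp
      have hp' := l1 p (List.mem_toFinset.1 hp)
      exact ⟨hfrom p hp'.1, (hA p hp'.1 hp'.2).1, (hA p hp'.1 hp'.2).2, (hincl _).2 hp'.2⟩
    · intro v hv
      exact l2 v ((hincl v).1 hv)
    · intro p hp hpI hd hpn ha
      exact l3 p (hreach p hp hd ha) ((hincl _).1 hpI) (fun h => hpn (List.mem_toFinset.2 h)) ha
    · intro p hp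
      have hp' := g1 p (List.mem_toFinset.1 hp)
      have hp2 := h1sub p hp'.1
      exact ⟨hfrom p hp2, (hA p hp2 hp'.2).1, (hA p hp2 hp'.2).2, (hincl _).2 hp'.2,
        fun h => lnd.2.2 p (List.mem_toFinset.1 h) p hp'.1 rfl⟩
    · exact g2
    · intro p hp hpI hd hpl hpg ha
      have hp1 : p ∈ h1.2 :=
        (List.mem_append.1 (lperm.symm.subset (hreach p hp hd ha))).resolve_left
        fun h => hpl (List.mem_toFinset.2 h)
      exact g3 p hp1 ((hincl _).1 hpI) (fun h => hpg (List.mem_toFinset.2 h)) ha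
  · unfold Round.toService Round.included Round.served Round.overdue
    congr 1
    · exact List.toFinset_append
    · rw [List.toFinset_append, List.toFinset_append, List.toFinset_append, ← Finset.union_assoc]
      congr 1
      ext p
      simp only [Finset.mem_union, List.mem_toFinset, Finset.mem_filter, hb11, hb21, hb12, hact1,
        Round.included]
      constructor
      · rintro (⟨⟨h1, -⟩, h2, h3⟩ | ⟨⟨⟨h1, -⟩, -⟩, h2, h3⟩)
        · exact ⟨h1, h2, Or.inl h3⟩
        · exact ⟨h1, h2, Or.inr h3⟩
      · rintro ⟨h1, h2, h3⟩
        have ha := (σ p).arrival_le_deadline.trans h2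
        by_cases h : (σ p).item ∈ items.1
        · exact Or.inl ⟨⟨h1, ha⟩, h2, h⟩
        · exact Or.inr ⟨⟨⟨h1, ha⟩, fun h' => h h'.2⟩, h2, h3.resolve_left h⟩

theorem exists_overdue_of_root_le_surplus {U : List (Fin m)} (hU : U.Nodup) {t : ℝ}
    (ht : K.root ≤ surplus K σ U t) :
    ∃ p ∈ U, (σ p).deadline ≤ t ∧ K.item (σ p).item ≤ backlog σ U (σ p).item t := by
  rw [surplus_eq_sum] at ht
  obtain ⟨v, -, hv⟩ := Finset.exists_ne_zero_of_sum_ne_zero (K.root_pos.trans_le ht).ne'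
  have hlt : 0 < backlog σ U v t - K.item v := by
    by_contra hle
    exact hv (max_eq_right (not_lt.1 hle))
  have hb : backlog σ U v t ≠ 0 := by
    have := K.item_nonneg v
    intro h0
    linarith
  rw [backlog_eq_sum σ hU] at hb
  obtain ⟨p, hp, hp0⟩ := Finset.exists_ne_zero_of_sum_ne_zero hb
  obtain ⟨rfl, hd⟩ : (σ p).item = v ∧ (σ p).deadline ≤ t := by
    by_contra hn
    exact hp0 (if_neg hn)
  exact ⟨p, List.mem_toFinset.1 hp, hd, (sub_pos.1 hlt).le⟩

theorem Round.sum_overdue_singleton {R : Round n m} {U : List (Fin m)} (hU : U.Nodup)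
    (hR : R.pending = U.toFinset) (v : Fin n) :
    ∑ p ∈ R.overdue σ {v}, (σ p).cost R.time = backlog σ U v R.time := by
  rw [backlog_eq_sum σ hU, Round.overdue, Finset.sum_filter, hR]
  refine Finset.sum_congr rfl fun p _ => ?_
  simp only [overdueCost, Finset.mem_singleton, and_comm]

/-- A service that is triggered satisfies at least one request. -/
theorem length_serve_lt {U : List (Fin m)} (hU : U.Nodup) {t : ℝ}
    (ht : K.root ≤ surplus K σ U t) : (serve K σ t U).val.2.length < U.length := by
  obtain ⟨R, rfl, hR, hph, -, hnd, hrest⟩ := exists_round K σ t hU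
  obtain ⟨p, hp, hd, hm⟩ := exists_overdue_of_root_le_surplus K σ hU ht
  rw [← List.toFinset_card_of_nodup hU, ← List.toFinset_card_of_nodup hnd, hrest, ← hR]
  have hpR : p ∈ R.pending := hR ▸ List.mem_toFinset.2 hp
  refine Finset.card_lt_card ⟨Finset.sdiff_subset, fun hsub => ?_⟩
  refine (Finset.mem_sdiff.1 (hsub hpR)).2 (Finset.mem_union_left _ ?_)
  refine Finset.mem_filter.2 ⟨hpR, hd, Finset.mem_union_left _ ((hph.mem_mature _).2 ?_)⟩
  rwa [Round.sum_overdue_singleton σ hU hR]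

end Rounds

/-! ### The algorithm is online -/

section Online

open Timed

/-- The same request at the same position of two request sequences. -/
def SameRequest {n m m' : ℕ} (σ : Fin m → Request n) (σ' : Fin m' → Request n) (p : Fin m)
    (p' : Fin m') : Prop :=
  p.val = p'.val ∧ σ p = σ' p'

section Lists

variable {α β : Type} {R : α → β → Prop} {l : List α} {l' : List β}

theorem forall₂_filter {q : α → Bool} {q' : β → Bool} (h : List.Forall₂ R l l')
    (hq : ∀ a b, R a b → q a = q' b) : List.Forall₂ R (l.filter q) (l'.filter q') := by
  induction h with
  | nil => simp
  | cons hab _ ih =>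
    rename_i a b _ _ _
    cases hb : q' b <;> simp [hq _ _ hab, hb, ih, hab]

theorem map_eq_map_of_forall₂ {γ : Type} {f : α → γ} {f' : β → γ} (h : List.Forall₂ R l l')
    (hf : ∀ a b, R a b → f a = f' b) : l.map f = l'.map f' := by
  induction h with
  | nil => rfl
  | cons hab _ ih => simp [hf _ _ hab, ih]

theorem any_eq_any_of_forall₂ {q : α → Bool} {q' : β → Bool} (h : List.Forall₂ R l l')
    (hq : ∀ a b, R a b → q a = q' b) : l.any q = l'.any q' := by
  induction h with
  | nil => rfl
  | cons hab _ ih => simp [hq _ _ hab, ih]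

theorem forall₂_append {l₂ : List α} {l₂' : List β} (h : List.Forall₂ R l l')
    (h₂ : List.Forall₂ R l₂ l₂') : List.Forall₂ R (l ++ l₂) (l' ++ l₂') := by
  induction h with
  | nil => simpa using h₂
  | cons hab _ ih => simp [hab, ih]

theorem Timed.forall₂_partition {q : α → Timed Bool} {q' : β → Timed Bool}
    (h : List.Forall₂ R l l') (hq : ∀ a b, R a b → (q a).val = (q' b).val) :
    List.Forall₂ R (partition q l).val.1 (partition q' l').val.1 ∧
      List.Forall₂ R (partition q l).val.2 (partition q' l').val.2 := by
  rw [val_partition, val_partition]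
  exact ⟨forall₂_filter h hq, forall₂_filter h fun a b hab => by rw [hq a b hab]⟩

theorem Timed.forall₂_insert {key : α → Timed EReal} {key' : β → Timed EReal} {a : α} {b : β}
    (h : List.Forall₂ R l l') (hk : ∀ a b, R a b → (key a).val = (key' b).val) (hab : R a b) :
    List.Forall₂ R (insert key a l).val (insert key' b l').val := by
  rw [val_insert, val_insert]
  induction h with
  | nil => simpa using hab
  | @cons c d l l' hcd h ih =>
    rw [List.orderedInsert_cons, List.orderedInsert_cons, hk _ _ hab, hk _ _ hcd]
    split_ifs
    · exact .cons hab (.cons hcd h)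
    · exact .cons hcd ih

theorem Timed.forall₂_sort {key : α → Timed EReal} {key' : β → Timed EReal}
    (h : List.Forall₂ R l l') (hk : ∀ a b, R a b → (key a).val = (key' b).val) :
    List.Forall₂ R (sort key l).val (sort key' l').val := by
  induction h with
  | nil => exact .nil
  | cons hab _ ih => exact forall₂_insert ih hk hab

theorem Timed.forall₂_takePrefix {f : α → Timed ℝ} {f' : β → Timed ℝ} (cap acc : ℝ)
    (h : List.Forall₂ R l l') (hf : ∀ a b, R a b → (f a).val = (f' b).val) :
    List.Forall₂ R (takePrefix f cap acc l).val.1 (takePrefix f' cap acc l').val.1 ∧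
      List.Forall₂ R (takePrefix f cap acc l).val.2 (takePrefix f' cap acc l').val.2 := by
  induction h generalizing acc with
  | nil => exact ⟨.nil, .nil⟩
  | @cons a b l l' hab h ih =>
    by_cases hc : acc + (f' b).val ≤ cap
    · simpa [takePrefix, hf _ _ hab, hc, hab] using ih (acc + (f' b).val)
    · simp [takePrefix, hf _ _ hab, hc, hab, h]

end Lists

variable {n m m' : ℕ} (K : Costs n) {σ : Fin m → Request n} {σ' : Fin m' → Request n}

theorem forall₂_holdingPhase (t c : ℝ) (I : List (Fin n)) {R : List (Fin m)} {R' : List (Fin m')}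
    (h : List.Forall₂ (SameRequest σ σ') R R') :
    List.Forall₂ (SameRequest σ σ') (holdingPhase σ t c I R).val.1
        (holdingPhase σ' t c I R').val.1 ∧
      List.Forall₂ (SameRequest σ σ') (holdingPhase σ t c I R).val.2
        (holdingPhase σ' t c I R').val.2 := by
  unfold holdingPhase
  simp only [val_bind, val_pure, val_append]
  have h1 := forall₂_partition (q := fun p => do
      let i ← itemIn σ I p
      if i then do
        let x ← evalCost (σ p) t
        Timed.le x c
      else pure false) (q' := fun p => do
      let i ← itemIn σ' I p
      if i then do
        let x ← evalCost (σ' p) t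
        Timed.le x c
      else pure false) h (fun a b hab => by
        by_cases hI : (σ' b).item ∈ I <;> simp [hab.2, hI])
  have h2 := forall₂_sort (key := fun p => Timed.virtualDeadline (σ p) t)
    (key' := fun p => Timed.virtualDeadline (σ' p) t) h1.1 (fun a b hab => by simp [hab.2])
  have h3 := forall₂_takePrefix (f := fun p => evalCost (σ p) t) (f' := fun p => evalCost (σ' p) t)
    (Timed.add c c).val 0 h2 (fun a b hab => by simp [hab.2])
  exact ⟨h3.1, forall₂_append h3.2 h1.2⟩

theorem forall₂_localPhases (t : ℝ) (I : List (Fin n)) {R : List (Fin m)} {R' : List (Fin m')}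
    (h : List.Forall₂ (SameRequest σ σ') R R') :
    List.Forall₂ (SameRequest σ σ') (localPhases K σ t I R).val.1
        (localPhases K σ' t I R').val.1 ∧
      List.Forall₂ (SameRequest σ σ') (localPhases K σ t I R).val.2
        (localPhases K σ' t I R').val.2 := by
  induction I generalizing R R' with
  | nil => exact ⟨.nil, h⟩
  | cons v I ih =>
    have h1 := forall₂_holdingPhase t (K.item v) [v] h
    have h2 := ih h1.2
    simp only [localPhases, val_bind, val_pure, val_append]
    exact ⟨forall₂_append h1.1 h2.1, h2.2⟩

theorem backlog_congr {U : List (Fin m)} {U' : List (Fin m')}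
    (h : List.Forall₂ (SameRequest σ σ') U U') (v : Fin n) (t : ℝ) :
    backlog σ U v t = backlog σ' U' v t := by
  unfold backlog
  rw [map_eq_map_of_forall₂ (forall₂_filter h fun a b hab => by rw [hab.2])
    fun a b hab => by rw [hab.2]]

theorem matureHat_congr {A : List (Fin m)} {A' : List (Fin m')}
    (h : List.Forall₂ (SameRequest σ σ') A A') (t : ℝ) :
    JRP.matureHat K σ A t = JRP.matureHat K σ' A' t := by
  funext v
  unfold JRP.matureHat
  congr 2
  ext s
  simp only [Set.mem_ofPred_eq]
  rw [map_eq_map_of_forall₂ (forall₂_filter h fun a b hab => by rw [hab.2])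
      fun a b hab => by rw [hab.2],
    map_eq_map_of_forall₂ (forall₂_filter h fun a b hab => by rw [hab.2])
      fun a b hab => by rw [hab.2]]

/-- A service at time `t ≤ T` depends only on the requests that arrive up to time `T`. -/
theorem serve_congr {t T : ℝ} (htT : t ≤ T) {U : List (Fin m)} {U' : List (Fin m')}
    (h : List.Forall₂ (SameRequest σ σ') (U.filter fun p => decide ((σ p).arrival ≤ T))
      (U'.filter fun p => decide ((σ' p).arrival ≤ T))) :
    (serve K σ t U).val.1.time = (serve K σ' t U').val.1.time ∧
    (serve K σ t U).val.1.items = (serve K σ' t U').val.1.items ∧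
    (serve K σ t U).val.1.reqs.map Fin.valEmbedding =
      (serve K σ' t U').val.1.reqs.map Fin.valEmbedding ∧
    List.Forall₂ (SameRequest σ σ')
      ((serve K σ t U).val.2.filter fun p => decide ((σ p).arrival ≤ T))
      ((serve K σ' t U').val.2.filter fun p => decide ((σ' p).arrival ≤ T)) := by
  have hT : ∀ a b, SameRequest σ σ' a b →
      decide ((σ a).arrival ≤ T) = decide ((σ' b).arrival ≤ T) := fun a b hab => by rw [hab.2]
  -- the active requests at time `t` have arrived by time `T`
  have hA : List.Forall₂ (SameRequest σ σ')
      (partition (fun p => Timed.le (σ p).arrival t) U).val.1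
      (partition (fun p => Timed.le (σ' p).arrival t) U').val.1 := by
    have := forall₂_filter (q := fun p => decide ((σ p).arrival ≤ t))
      (q' := fun p => decide ((σ' p).arrival ≤ t)) h fun a b hab => by rw [hab.2]
    rw [List.filter_filter, List.filter_filter] at this
    simp only [val_partition, val_le]
    convert this using 3
    · rename_i p
      by_cases hp : (σ p).arrival ≤ t
      · simp [hp, hp.trans htT]
      · simp [hp]
    · rename_i p
      by_cases hp : (σ' p).arrival ≤ t
      · simp [hp, hp.trans htT]
      · simp [hp]
  have hW : List.Forall₂ (SameRequest σ σ')
      ((partition (fun p => Timed.le (σ p).arrival t) U).val.2.filter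
        fun p => decide ((σ p).arrival ≤ T))
      ((partition (fun p => Timed.le (σ' p).arrival t) U').val.2.filter
        fun p => decide ((σ' p).arrival ≤ T)) := by
    have := forall₂_filter (q := fun p => !decide ((σ p).arrival ≤ t))
      (q' := fun p => !decide ((σ' p).arrival ≤ t)) h fun a b hab => by rw [hab.2]
    rw [List.filter_filter, List.filter_filter] at this
    simp only [val_partition, val_le]
    rw [List.filter_filter, List.filter_filter]
    convert this using 3
    · exact Bool.and_comm _ _
    · exact Bool.and_comm _ _
  unfold serve
  simp only [val_bind, val_pure, val_append]
  generalize (partition (fun p => Timed.le (σ p).arrival t) U).val = act at hA hW ⊢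
  generalize (partition (fun p => Timed.le (σ' p).arrival t) U').val = act' at hA hW ⊢
  have hI : (partition (isMature K σ act.1 t) (List.finRange n)).val =
      (partition (isMature K σ' act'.1 t) (List.finRange n)).val := by
    simp only [val_partition, val_isMature, backlog_congr hA]
  rw [hI]
  generalize (partition (isMature K σ' act'.1 t) (List.finRange n)).val = items
  have hB1 := forall₂_partition (q := overdueIn σ t items.1) (q' := overdueIn σ' t items.1) hA
    (fun a b hab => by simp [hab.2])
  have hP : (partition (fun v => any (fun p => sameItem v (σ p).item) act.1) items.2).val =
      (partition (fun v => any (fun p => sameItem v (σ' p).item) act'.1) items.2).val := by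
    have : ∀ v, (act.1.any fun p => (sameItem v (σ p).item).val) =
        act'.1.any fun p => (sameItem v (σ' p).item).val := fun v =>
      any_eq_any_of_forall₂ hA fun a b hab => by rw [hab.2]
    simp only [val_partition, val_any, this]
  rw [hP]
  generalize (partition (fun v => any (fun p => sameItem v (σ' p).item) act'.1) items.2).val
    = prem
  have hS : (sort (Timed.matureHat K σ act.1 t) prem.1).val =
      (sort (Timed.matureHat K σ' act'.1 t) prem.1).val := by
    have := forall₂_sort (R := Eq) (key := Timed.matureHat K σ act.1 t)
      (key' := Timed.matureHat K σ' act'.1 t) (List.forall₂_refl prem.1)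
      (fun a b e => by rw [val_matureHat, val_matureHat, matureHat_congr K hA, e])
    rwa [List.forall₂_eq_eq_eq] at this
  rw [hS]
  generalize (takePrefix (fun v => (pure (K.item v) : Timed ℝ)) (Timed.add K.root K.root).val 0
    (sort (Timed.matureHat K σ' act'.1 t) prem.1).val).val = chosen
  have hB2 := forall₂_partition (q := overdueIn σ t chosen.1) (q' := overdueIn σ' t chosen.1)
    hB1.2 (fun a b hab => by simp [hab.2])
  have hH1 := forall₂_localPhases K t (items.1 ++ chosen.1) hB2.2
  have hH2 := forall₂_holdingPhase t K.root (items.1 ++ chosen.1) hH1.2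
  refine ⟨trivial, rfl, ?_, ?_⟩
  · have := map_eq_map_of_forall₂ (f := Fin.val) (f' := Fin.val)
      (forall₂_append hB1.1 (forall₂_append hB2.1 (forall₂_append hH1.1 hH2.1)))
      (fun a b hab => hab.1)
    ext x
    have hx : ∀ {k : ℕ} (l : List (Fin k)),
        x ∈ l.toFinset.map Fin.valEmbedding ↔ x ∈ l.map Fin.val := by
      intro k l
      simp
    rw [hx, hx, this]
  · rw [List.filter_append, List.filter_append]
    exact forall₂_append (forall₂_filter hH2.2 hT) hW

theorem surplus_congr {T : ℝ} {U : List (Fin m)} {U' : List (Fin m')}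
    (h : List.Forall₂ (SameRequest σ σ') (U.filter fun p => decide ((σ p).arrival ≤ T))
      (U'.filter fun p => decide ((σ' p).arrival ≤ T))) {s : ℝ} (hs : s ≤ T) :
    surplus K σ U s = surplus K σ' U' s := by
  have key : ∀ {k : ℕ} (τ : Fin k → Request n) (V : List (Fin k)) (v : Fin n),
      backlog τ (V.filter fun p => decide ((τ p).arrival ≤ T)) v s = backlog τ V v s := by
    intro k τ V v
    unfold backlog
    rw [List.filter_filter]
    congr 3
    funext p
    by_cases hp : (τ p).deadline ≤ s
    · simp [hp, (τ p).arrival_le_deadline.trans (hp.trans hs)]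
    · simp [hp]
  have hb : ∀ v, backlog σ U v s = backlog σ' U' v s := fun v => by
    rw [← key σ U v, ← key σ' U' v, backlog_congr h]
  simp only [surplus_eq_sum, hb]

theorem lt_time_of_mem_run {T : ℝ} (k : ℕ) {U : List (Fin m)} (hU : U.Nodup)
    (hT : ∀ s, K.root ≤ surplus K σ U s → T < s) : ∀ S ∈ (run K σ k U).val, T < S.time := by
  induction k generalizing U with
  | zero => simp [run]
  | succ k ih =>
    simp only [run, val_bind, val_triggerTime]
    cases h : JRP.triggerTime K σ U with
    | none => simp
    | some t =>
      obtain ⟨q, -, hq⟩ := serve_perm K σ t U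
      have hnd := (hq.nodup_iff.2 hU)
      simp only [val_bind, val_pure, List.mem_cons]
      rintro S (rfl | hS)
      · exact hT _ ((triggerTime_eq_some_iff K σ hU t).1 h).1
      · have hnd2 := (List.nodup_append.1 hnd).2.1
        exact ih hnd2 (fun s hs => hT s (hs.trans (surplus_mono K σ hnd2 hU
          (fun p hp => hq.subset (List.mem_append_right _ hp)) le_rfl))) S hS

theorem servicesUpTo_eq_nil {T : ℝ} {L : List (Service n m)} (h : ∀ S ∈ L, T < S.time) :
    servicesUpTo T L = [] := by
  unfold servicesUpTo
  rw [List.map_eq_nil_iff, List.filter_eq_nil_iff]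
  intro S hS
  simpa using h S hS

theorem ne_nil_of_root_le_surplus {U : List (Fin m)} {t : ℝ}
    (ht : K.root ≤ surplus K σ U t) : U ≠ [] := by
  rintro rfl
  refine absurd ht (not_le.2 ?_)
  have : surplus K σ [] t = 0 := by
    rw [surplus_eq_sum]
    exact Finset.sum_eq_zero fun v _ => max_eq_right (by simp [backlog, K.item_nonneg v])
  rw [this]
  exact K.root_pos

/-- Runs on request lists that agree up to time `T` have the same services up to time `T`, for any
bounds on the number of rounds that are at least the numbers of requests. -/
theorem servicesUpTo_run_congr {T : ℝ} (k k' : ℕ) {U : List (Fin m)} {U' : List (Fin m')}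
    (hU : U.Nodup) (hU' : U'.Nodup) (hk : U.length ≤ k) (hk' : U'.length ≤ k')
    (h : List.Forall₂ (SameRequest σ σ') (U.filter fun p => decide ((σ p).arrival ≤ T))
      (U'.filter fun p => decide ((σ' p).arrival ≤ T))) :
    servicesUpTo T (run K σ k U).val = servicesUpTo T (run K σ' k' U').val := by
  induction k generalizing k' U U' with
  | zero =>
    obtain rfl := List.length_eq_zero_iff.1 (Nat.le_zero.1 hk)
    rw [eq_comm]
    refine servicesUpTo_eq_nil (lt_time_of_mem_run K k' hU' fun s hs => ?_)
    by_contra hsT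
    rw [← surplus_congr K h (not_lt.1 hsT)] at hs
    exact ne_nil_of_root_le_surplus K hs rfl
  | succ k ih =>
    by_cases hτ : ∃ t ≤ T, JRP.triggerTime K σ U = some t
    · obtain ⟨t, htT, ht⟩ := hτ
      have hl := (triggerTime_eq_some_iff K σ hU t).1 ht
      have ht1 : K.root ≤ surplus K σ U t := hl.1
      have ht1' : K.root ≤ surplus K σ' U' t := surplus_congr K h htT ▸ ht1
      have hl' : JRP.triggerTime K σ' U' = some t := by
        refine (triggerTime_eq_some_iff K σ' hU' t).2 ⟨ht1', fun s hs => ?_⟩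
        by_contra hst
        have hsT : s ≤ T := (not_le.1 hst).le.trans htT
        have hs : K.root ≤ surplus K σ' U' s := hs
        rw [← surplus_congr K h hsT] at hs
        exact hst (hl.2 hs)
      obtain ⟨k', rfl⟩ : ∃ j, k' = j + 1 := Nat.exists_eq_succ_of_ne_zero fun h0 =>
        ne_nil_of_root_le_surplus K ht1' (List.length_eq_zero_iff.1 (by omega))
      have c := serve_congr K htT h
      have d := length_serve_lt K σ hU ht1
      have d' := length_serve_lt K σ' hU' ht1'
      obtain ⟨-, -, -, -, -, hnd, -⟩ := exists_round K σ t hU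
      obtain ⟨-, -, -, -, -, hnd', -⟩ := exists_round K σ' t hU'
      have e := ih k' hnd hnd' (by omega) (by omega) c.2.2.2
      have hcons : ∀ {j : ℕ} (S : Service n j) (L : List (Service n j)),
          servicesUpTo T (S :: L) = if S.time ≤ T then
            (S.time, S.items, S.reqs.map Fin.valEmbedding) :: servicesUpTo T L
          else servicesUpTo T L := by
        intro j S L
        by_cases hS : S.time ≤ T <;> simp [servicesUpTo, hS]
      simp only [run, val_bind, val_triggerTime, ht, hl', val_pure]
      rw [hcons, hcons, c.1, c.2.1, c.2.2.1, e]
    · have h1 : ∀ s, K.root ≤ surplus K σ U s → T < s := by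
        intro s hs
        cases ht : JRP.triggerTime K σ U with
        | none => exact absurd hs (not_le.2 ((triggerTime_eq_none_iff K σ U).1 ht s))
        | some t =>
          refine (not_le.1 fun htT => hτ ⟨t, htT, ht⟩).trans_le ?_
          exact ((triggerTime_eq_some_iff K σ hU t).1 ht).2 hs
      rw [servicesUpTo_eq_nil (lt_time_of_mem_run K _ hU h1), eq_comm]
      refine servicesUpTo_eq_nil (lt_time_of_mem_run K k' hU' fun s hs => ?_)
      by_contra hsT
      rw [← surplus_congr K h (not_lt.1 hsT)] at hs
      exact hsT (h1 s hs)

/-- The requests that have arrived are at the same positions in both sequences. -/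
theorem forall₂_finRange {T : ℝ} (h : ∀ (i : ℕ) (p : Request n), p.arrival ≤ T →
    ((∃ h : i < m, σ ⟨i, h⟩ = p) ↔ ∃ h : i < m', σ' ⟨i, h⟩ = p)) :
    List.Forall₂ (SameRequest σ σ')
      ((List.finRange m).filter fun p => decide ((σ p).arrival ≤ T))
      ((List.finRange m').filter fun p => decide ((σ' p).arrival ≤ T)) := by
  have hsorted : ∀ {j : ℕ} (q : Fin j → Bool),
      (((List.finRange j).filter q).map Fin.val).Pairwise (· < ·) := fun q =>
    List.pairwise_map.2 ((List.pairwise_lt_finRange _).filter _)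
  have hmap : ((List.finRange m).filter fun p => decide ((σ p).arrival ≤ T)).map Fin.val =
      ((List.finRange m').filter fun p => decide ((σ' p).arrival ≤ T)).map Fin.val := by
    refine List.Perm.eq_of_pairwise (le := (· < ·)) (fun a b _ _ h1 h2 => absurd h1 h2.asymm)
      (hsorted _) (hsorted _) ?_
    rw [List.perm_ext_iff_of_nodup ((hsorted _).imp ne_of_lt) ((hsorted _).imp ne_of_lt)]
    intro i
    simp only [List.mem_map, List.mem_filter, List.mem_finRange, true_and, decide_eq_true_eq]
    constructor
    · rintro ⟨a, ha, rfl⟩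
      obtain ⟨h1, h2⟩ := (h a (σ a) ha).1 ⟨a.2, rfl⟩
      exact ⟨⟨a, h1⟩, h2.symm ▸ ha, rfl⟩
    · rintro ⟨a, ha, rfl⟩
      obtain ⟨h1, h2⟩ := (h a (σ' a) ha).2 ⟨a.2, rfl⟩
      exact ⟨⟨a, h1⟩, h2.symm ▸ ha, rfl⟩
  rw [← List.forall₂_eq_eq_eq, List.forall₂_map_left_iff, List.forall₂_map_right_iff] at hmap
  have hand := (List.forall₂_and_left (p := fun a => (σ a).arrival ≤ T) _ _).2
    ⟨fun a ha => by simpa using (List.mem_filter.1 ha).2, hmap⟩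
  refine hand.imp fun a b hab => ⟨hab.2, ?_⟩
  obtain ⟨h1, h2⟩ := (h a (σ a) hab.1).1 ⟨a.2, rfl⟩
  rw [← h2]
  congr 1
  exact Fin.ext hab.2

theorem fourPhase_isOnline : IsOnline fourPhase := by
  intro n m m' K σ σ' T h
  exact servicesUpTo_run_congr K m m' (List.nodup_finRange m) (List.nodup_finRange m')
    (by simp) (by simp) (forall₂_finRange h)

end Online

/-! ### Runs of the algorithm as sequences of rounds -/

section Trace

open Timed Filter Topology

variable {n m : ℕ} (K : Costs n) (σ : Fin m → Request n)

/-- The surplus backlog of the mature items of a round. -/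
noncomputable def Round.surplus (R : Round n m) : ℝ :=
  ∑ v ∈ R.mature, (∑ p ∈ R.overdue σ {v}, (σ p).cost R.time - K.item v)

/-- The first `k` entries of `R` are the rounds of a run that satisfies all requests. -/
structure Trace (k : ℕ) (R : ℕ → Round n m) : Prop where
  phases : ∀ i < k, (R i).FollowsPhases K σ
  root_le_surplus : ∀ i < k, K.root ≤ (R i).surplus K σ
  /-- The surplus exceeds the joint cost at most by the costs of the requests whose deadline is
  the time of the service. -/
  surplus_le : ∀ i < k, (R i).surplus K σ ≤ K.root +
    ∑ p ∈ (R i).overdue σ (R i).mature with (σ p).deadline = (R i).time, (σ p).cost (R i).time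
  pending_succ : ∀ i < k, (R (i + 1)).pending = (R i).pending \ (R i).served σ
  pending_last : (R k).pending = ∅
  time_lt : ∀ i, i + 1 < k → (R i).time < (R (i + 1)).time

variable {K σ}

theorem Round.FollowsPhases.surplus_eq {R : Round n m} (hR : R.FollowsPhases K σ)
    {U : List (Fin m)} (hU : U.Nodup) (hp : R.pending = U.toFinset) :
    R.surplus K σ = JRP.surplus K σ U R.time := by
  unfold JRP.surplus Round.surplus
  rw [← Finset.sum_filter]
  refine Finset.sum_congr ?_ fun v _ => by rw [R.sum_overdue_singleton σ hU hp]
  ext v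
  rw [hR.mem_mature, R.sum_overdue_singleton σ hU hp]
  simp

/-- The backlog of the requests whose deadline is earlier is continuous at the trigger time, so it
does not exceed the joint cost. -/
theorem Round.surplus_le {R : Round n m} {U : List (Fin m)} (hU : U.Nodup)
    (hp : R.pending = U.toFinset) (ht : IsLeast {t | K.root ≤ JRP.surplus K σ U t} R.time) :
    R.surplus K σ ≤ K.root + ∑ p ∈ R.overdue σ R.mature with (σ p).deadline = R.time,
      (σ p).cost R.time := by
  set t := R.time with htdef
  set early := U.toFinset.filter fun p => (σ p).deadline < t with hearly
  set f : ℝ → ℝ := fun s => ∑ v, max (∑ p ∈ early, overdueCost σ v s p - K.item v) 0 with hf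
  have hcont : ContinuousAt f t := by
    refine tendsto_finsetSum _ fun v _ => Tendsto.max (Tendsto.sub ?_ tendsto_const_nhds)
      tendsto_const_nhds
    refine tendsto_finsetSum _ fun p hpe => ?_
    have hd : (σ p).deadline < t := (Finset.mem_filter.1 hpe).2
    by_cases hv : (σ p).item = v
    · have hc : ContinuousAt (σ p).cost t :=
        (σ p).backlog_continuous.continuousAt (Ici_mem_nhds hd)
      have he : (σ p).cost =ᶠ[𝓝 t] fun s => overdueCost σ v s p := by
        filter_upwards [Ici_mem_nhds hd] with s hs
        rw [overdueCost, if_pos ⟨hv, hs⟩]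
      exact hc.congr he
    · simp only [overdueCost, hv, false_and, if_false]
      exact tendsto_const_nhds
  have hft : f t ≤ K.root := by
    refine le_of_tendsto (hcont.mono_left nhdsWithin_le_nhds : Tendsto f (𝓝[<] t) _) ?_
    filter_upwards [self_mem_nhdsWithin] with s hs
    have hlt : JRP.surplus K σ U s < K.root := by
      by_contra h
      exact absurd (ht.2 (not_lt.1 h)) (not_le.2 hs)
    refine le_trans ?_ hlt.le
    rw [surplus_eq_sum]
    refine Finset.sum_le_sum fun v _ => max_le_max (sub_le_sub_right ?_ _) le_rfl
    rw [backlog_eq_sum σ hU]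
    exact Finset.sum_le_sum_of_subset_of_nonneg (Finset.filter_subset _ _)
      fun p _ _ => overdueCost_nonneg σ v s p
  have hsplit : ∀ v, ∑ p ∈ R.overdue σ {v}, (σ p).cost t = ∑ p ∈ early, overdueCost σ v t p +
      ∑ p ∈ R.overdue σ {v} with (σ p).deadline = t, (σ p).cost t := by
    intro v
    rw [R.sum_overdue_singleton σ hU hp, backlog_eq_sum σ hU,
      ← Finset.sum_filter_add_sum_filter_not _ (fun p => (σ p).deadline < t)]
    congr 1
    unfold overdueCost Round.overdue
    rw [← Finset.sum_filter, hp, Finset.filter_filter, Finset.filter_filter]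
    refine Finset.sum_congr (Finset.filter_congr fun p _ => ?_) fun _ _ => rfl
    simp only [Finset.mem_singleton, ← htdef]
    constructor
    · rintro ⟨h1, h2, h3⟩
      exact ⟨⟨h3, h2⟩, le_antisymm h3 (not_lt.1 h1)⟩
    · rintro ⟨⟨h1, h2⟩, h3⟩
      exact ⟨h3.not_lt, h2, h1⟩
  have hfib : ∑ p ∈ R.overdue σ R.mature with (σ p).deadline = t, (σ p).cost t =
      ∑ v ∈ R.mature, ∑ p ∈ R.overdue σ {v} with (σ p).deadline = t, (σ p).cost t := by
    rw [← Finset.sum_fiberwise_of_maps_to (t := R.mature) (g := fun p => (σ p).item)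
      (fun p hp => (Finset.mem_filter.1 (Finset.mem_filter.1 hp).1).2.2)]
    refine Finset.sum_congr rfl fun v hv => Finset.sum_congr ?_ fun _ _ => rfl
    unfold Round.overdue
    ext p
    simp only [Finset.mem_filter, Finset.mem_singleton]
    constructor
    · rintro ⟨⟨⟨h1, h2, -⟩, h3⟩, h4⟩
      exact ⟨⟨h1, h2, h4⟩, h3⟩
    · rintro ⟨⟨h1, h2, h4⟩, h3⟩
      exact ⟨⟨⟨h1, h2, h4.symm ▸ hv⟩, h3⟩, h4⟩
  calc R.surplus K σ
      ≤ ∑ v ∈ R.mature, (max (∑ p ∈ early, overdueCost σ v t p - K.item v) 0 +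
          ∑ p ∈ R.overdue σ {v} with (σ p).deadline = t, (σ p).cost t) := by
        refine Finset.sum_le_sum fun v _ => ?_
        rw [← htdef, hsplit]
        linarith [le_max_left (∑ p ∈ early, overdueCost σ v t p - K.item v) 0]
    _ = ∑ v ∈ R.mature, max (∑ p ∈ early, overdueCost σ v t p - K.item v) 0 +
          ∑ p ∈ R.overdue σ R.mature with (σ p).deadline = t, (σ p).cost t := by
        rw [Finset.sum_add_distrib, hfib]
    _ ≤ _ := by
        refine add_le_add ((Finset.sum_le_sum_of_subset_of_nonneg (Finset.subset_univ _)
          fun v _ _ => le_max_right _ _).trans hft) le_rfl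

theorem eq_nil_of_triggerTime_eq_none {U : List (Fin m)} (hU : U.Nodup)
    (hurg : ∀ p, EventuallyUrgent K (σ p)) (h : triggerTime K σ U = none) : U = [] := by
  rw [List.eq_nil_iff_forall_not_mem]
  intro p hp
  obtain ⟨t, hd, ht⟩ := hurg p
  refine absurd ((triggerTime_eq_none_iff K σ U).1 h t) (not_lt.2 ?_)
  have hb : (σ p).cost t ≤ backlog σ U (σ p).item t := by
    rw [backlog_eq_sum σ hU]
    refine le_trans (le_of_eq ?_) (Finset.single_le_sum
      (fun q _ => overdueCost_nonneg σ (σ p).item t q) (List.mem_toFinset.2 hp))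
    rw [overdueCost, if_pos ⟨rfl, hd⟩]
  rw [surplus_eq_sum]
  refine le_trans ?_ (Finset.single_le_sum
    (f := fun v => max (backlog σ U v t - K.item v) 0)
    (fun v _ => le_max_right _ _) (Finset.mem_univ (σ p).item))
  exact le_trans (by linarith) (le_max_left _ _)

/-- After a service the next trigger is strictly later. -/
theorem Round.FollowsPhases.lt_of_root_le_surplus {R : Round n m} (hR : R.FollowsPhases K σ)
    {U U' : List (Fin m)} (hU : U.Nodup) (hp : R.pending = U.toFinset) (hU' : U'.Nodup)
    (hp' : U'.toFinset = R.pending \ R.served σ) {s : ℝ} (hs : K.root ≤ JRP.surplus K σ U' s) :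
    R.time < s := by
  have hsub : ∀ p ∈ U', p ∈ U ∧ p ∉ R.served σ := by
    intro p hpU
    have := List.mem_toFinset.2 hpU
    rw [hp', hp, Finset.mem_sdiff, List.mem_toFinset] at this
    exact this
  by_contra hle
  obtain ⟨p, hpU, hd, hb⟩ := exists_overdue_of_root_le_surplus K σ hU'
    (hs.trans (surplus_mono K σ hU' hU' (List.Subset.refl _) (not_lt.1 hle)))
  refine (hsub p hpU).2 (Finset.mem_union_left _ (Finset.mem_filter.2
    ⟨hp ▸ List.mem_toFinset.2 (hsub p hpU).1, hd, Finset.mem_union_left _ ?_⟩))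
  rw [hR.mem_mature, R.sum_overdue_singleton σ hU hp]
  refine hb.trans ?_
  rw [backlog_eq_sum σ hU, backlog_eq_sum σ hU']
  exact Finset.sum_le_sum_of_subset_of_nonneg
    (fun q hq => List.mem_toFinset.2 (hsub q (List.mem_toFinset.1 hq)).1)
    fun q _ _ => overdueCost_nonneg σ _ _ q

/-- If all requests are eventually urgent, then a run triggers services until all requests are
satisfied, since an unsatisfied request alone makes the surplus reach the joint cost. -/
theorem exists_trace (hurg : ∀ p, EventuallyUrgent K (σ p)) (j : ℕ) {U : List (Fin m)}
    (hU : U.Nodup) (hj : U.length ≤ j) :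
    ∃ k R, Trace K σ k R ∧ (R 0).pending = U.toFinset ∧
      (run K σ j U).val = (List.range k).map (fun i => (R i).toService σ) ∧
      (0 < k → triggerTime K σ U = some (R 0).time) := by
  have hempty : ∃ R : ℕ → Round n m, Trace K σ 0 R ∧ (R 0).pending = ∅ := by
    refine ⟨fun _ => ⟨0, ∅, ∅, ∅, ∅, ∅⟩, ⟨?_, ?_, ?_, ?_, rfl, ?_⟩, rfl⟩ <;>
    · intro i hi
      omega
  induction j generalizing U with
  | zero =>
    obtain rfl := List.length_eq_zero_iff.1 (Nat.le_zero.1 hj)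
    obtain ⟨R, h1, h2⟩ := hempty
    exact ⟨0, R, h1, by simpa using h2, by simp [run], by simp⟩
  | succ j ih =>
    cases h : triggerTime K σ U with
    | none =>
      obtain rfl := eq_nil_of_triggerTime_eq_none hU hurg h
      obtain ⟨R, h1, h2⟩ := hempty
      exact ⟨0, R, h1, by simpa using h2, by simp [run, h], by simp⟩
    | some t =>
      have ht := (triggerTime_eq_some_iff K σ hU t).1 h
      have hlen := length_serve_lt K σ hU ht.1
      obtain ⟨R₀, rfl, hp, hph, hser, hnd, hrest⟩ := exists_round K σ t hU
      obtain ⟨k, R, hT, hR0, hrun, htrig⟩ := ih hnd (by omega)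
      refine ⟨k + 1, fun i => Nat.casesOn i R₀ R, ?_, hp, ?_, fun _ => rfl⟩
      · refine ⟨?_, ?_, ?_, ?_, hT.pending_last, ?_⟩
        · rintro (_ | i) hi
          · exact hph
          · exact hT.phases i (by omega)
        · rintro (_ | i) hi
          · exact (hph.surplus_eq hU hp).symm ▸ ht.1
          · exact hT.root_le_surplus i (by omega)
        · rintro (_ | i) hi
          · exact Round.surplus_le hU hp ht
          · exact hT.surplus_le i (by omega)
        · rintro (_ | i) hi
          · exact hR0.trans hrest
          · exact hT.pending_succ i (by omega)
        · rintro (_ | i) hi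
          · exact hph.lt_of_root_le_surplus hU hp hnd hrest
              ((triggerTime_eq_some_iff K σ hnd _).1 (htrig (by omega))).1
          · exact hT.time_lt i (by omega)
      · simp only [run, val_bind, val_triggerTime, h, val_pure]
        rw [List.range_succ_eq_map, List.map_cons, List.map_map, hser, hrun]
        rfl

theorem Round.FollowsPhases.served_subset {R : Round n m} (hR : R.FollowsPhases K σ) :
    R.served σ ⊆ R.pending := by
  refine Finset.union_subset (Finset.filter_subset _ _) (Finset.union_subset ?_ ?_)
  · exact fun p hp => (hR.mem_local p hp).1
  · exact fun p hp => (hR.mem_global p hp).1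

theorem Round.FollowsPhases.of_mem_served {R : Round n m} (hR : R.FollowsPhases K σ) {p : Fin m}
    (hp : p ∈ R.served σ) : (σ p).arrival ≤ R.time ∧ (σ p).item ∈ R.included := by
  rcases Finset.mem_union.1 hp with h | h
  · have := (Finset.mem_filter.1 h).2
    exact ⟨(σ p).arrival_le_deadline.trans this.1, this.2⟩
  · rcases Finset.mem_union.1 h with h | h
    · exact ⟨(hR.mem_local p h).2.1, (hR.mem_local p h).2.2.2⟩
    · exact ⟨(hR.mem_global p h).2.1, (hR.mem_global p h).2.2.2.1⟩

variable {k : ℕ} {R : ℕ → Round n m}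

theorem Trace.pending_subset (hT : Trace K σ k R) {i j : ℕ} (hij : i ≤ j) (hj : j ≤ k) :
    (R j).pending ⊆ (R i).pending := by
  induction j, hij using Nat.le_induction with
  | base => exact subset_rfl
  | succ j hij ih =>
    rw [hT.pending_succ j (by omega)]
    exact Finset.sdiff_subset.trans (ih (by omega))

theorem Trace.disjoint_served (hT : Trace K σ k R) {i j : ℕ} (hij : i < j) (hj : j < k) :
    Disjoint ((R i).served σ) ((R j).served σ) := by
  refine Finset.disjoint_left.2 fun p hi hpj => ?_
  have := hT.pending_subset (i := i + 1) (by omega) hj.le ((hT.phases j hj).served_subset hpj)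
  rw [hT.pending_succ i (by omega)] at this
  exact (Finset.mem_sdiff.1 this).2 hi

theorem Trace.exists_served (hT : Trace K σ k R) {p : Fin m} (hp : p ∈ (R 0).pending) :
    ∃ i < k, p ∈ (R i).served σ := by
  by_contra! h
  have key : ∀ i ≤ k, p ∈ (R i).pending := by
    intro i
    induction i with
    | zero => exact fun _ => hp
    | succ i ih =>
      intro hi
      rw [hT.pending_succ i (by omega)]
      exact Finset.mem_sdiff.2 ⟨ih (by omega), h i (by omega)⟩
  have := key k le_rfl
  rw [hT.pending_last] at this
  exact absurd this (Finset.notMem_empty p)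

theorem Trace.feasible (hT : Trace K σ k R) (h0 : (R 0).pending = Finset.univ) :
    Feasible σ ((List.range k).map fun i => (R i).toService σ) := by
  constructor
  · intro S hS p hp
    obtain ⟨i, hi, rfl⟩ := List.mem_map.1 hS
    exact ((hT.phases i (List.mem_range.1 hi)).of_mem_served hp).1
  · intro S hS p hp
    obtain ⟨i, hi, rfl⟩ := List.mem_map.1 hS
    exact ((hT.phases i (List.mem_range.1 hi)).of_mem_served hp).2
  · intro p
    obtain ⟨i, hi, hp⟩ := hT.exists_served (h0 ▸ Finset.mem_univ p)
    exact ⟨_, List.mem_map.2 ⟨i, List.mem_range.2 hi, rfl⟩, hp⟩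
  · rw [List.pairwise_map]
    exact List.pairwise_lt_range.imp_of_mem fun _ hb hij =>
      hT.disjoint_served hij (List.mem_range.1 hb)

theorem Trace.sum_served_le (hT : Trace K σ k R) {f : Fin m → ℝ} (hf : ∀ p, 0 ≤ f p) :
    ∑ i ∈ Finset.range k, ∑ p ∈ (R i).served σ, f p ≤ ∑ p, f p := by
  rw [← Finset.sum_biUnion]
  · exact Finset.sum_le_sum_of_subset_of_nonneg (Finset.subset_univ _) fun p _ _ => hf p
  · intro i hi j hj hij
    rcases lt_or_gt_of_ne hij with h | h
    · exact hT.disjoint_served h (Finset.mem_range.1 hj)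
    · exact (hT.disjoint_served h (Finset.mem_range.1 hi)).symm

theorem Round.sum_overdue (R : Round n m) (I : Finset (Fin n)) (f : Fin m → ℝ) :
    ∑ p ∈ R.overdue σ I, f p = ∑ v ∈ I, ∑ p ∈ R.overdue σ {v}, f p := by
  rw [← Finset.sum_fiberwise_of_maps_to (t := I) (g := fun p => (σ p).item)
    (fun p hp => (Finset.mem_filter.1 hp).2.2)]
  refine Finset.sum_congr rfl fun v hv => Finset.sum_congr ?_ fun _ _ => rfl
  ext p
  simp only [Round.overdue, Finset.mem_filter, Finset.mem_singleton]
  constructor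
  · rintro ⟨⟨h1, h2, -⟩, h3⟩
    exact ⟨h1, h2, h3⟩
  · rintro ⟨h1, h2, h3⟩
    exact ⟨⟨h1, h2, h3.symm ▸ hv⟩, h3⟩

theorem Round.FollowsPhases.sum_served {R : Round n m} (hR : R.FollowsPhases K σ)
    (f : Fin m → ℝ) :
    ∑ p ∈ R.served σ, f p = ∑ p ∈ R.overdue σ R.mature, f p + ∑ p ∈ R.overdue σ R.premature, f p +
      ∑ p ∈ R.localReqs, f p + ∑ p ∈ R.globalReqs, f p := by
  unfold Round.served
  rw [Finset.sum_union, Finset.sum_union, R.sum_overdue, Round.included,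
    Finset.sum_union hR.disjoint, ← R.sum_overdue, ← R.sum_overdue]
  · ring
  · exact Finset.disjoint_left.2 fun p hl hg => (hR.mem_global p hg).2.2.2.2 hl
  · refine Finset.disjoint_left.2 fun p ho hh => ?_
    have hd := (Finset.mem_filter.1 ho).2.1
    rcases Finset.mem_union.1 hh with h | h
    · exact absurd (hR.mem_local p h).2.2.1 (not_lt.2 hd)
    · exact absurd (hR.mem_global p h).2.2.1 (not_lt.2 hd)

theorem Round.FollowsPhases.sum_localReqs {R : Round n m} (hR : R.FollowsPhases K σ)
    (f : Fin m → ℝ) :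
    ∑ p ∈ R.localReqs, f p = ∑ v ∈ R.included, ∑ p ∈ R.localOf σ v, f p :=
  (Finset.sum_fiberwise_of_maps_to (fun p hp => (hR.mem_local p hp).2.2.2) f).symm

/-- The cost of a round in terms of the joint cost, the surplus backlog and the costs of its mature
items. -/
theorem Round.FollowsPhases.cost_le {R : Round n m} (hR : R.FollowsPhases K σ) :
    K.root + ∑ v ∈ R.included, K.item v + ∑ p ∈ R.served σ, (σ p).cost R.time ≤
      11 * K.root + R.surplus K σ + 4 * ∑ v ∈ R.mature, K.item v := by
  have h1 : ∑ v ∈ R.included, K.item v =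
      ∑ v ∈ R.mature, K.item v + ∑ v ∈ R.premature, K.item v := Finset.sum_union hR.disjoint
  have h2 : ∑ p ∈ R.overdue σ R.mature, (σ p).cost R.time =
      R.surplus K σ + ∑ v ∈ R.mature, K.item v := by
    rw [R.sum_overdue, Round.surplus, Finset.sum_sub_distrib]
    ring
  have h3 : ∑ p ∈ R.overdue σ R.premature, (σ p).cost R.time ≤ ∑ v ∈ R.premature, K.item v := by
    rw [R.sum_overdue]
    refine Finset.sum_le_sum fun v hv => ?_
    have hm := fun h => Finset.disjoint_left.1 hR.disjoint ((hR.mem_mature v).2 h) hv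
    exact (not_le.1 hm).le
  have h4 : ∑ p ∈ R.localReqs, (σ p).cost R.time ≤ ∑ v ∈ R.included, 2 * K.item v := by
    rw [hR.sum_localReqs]
    exact Finset.sum_le_sum fun v hv => hR.sum_local v hv
  rw [← Finset.mul_sum] at h4
  have h5 := hR.sum_global
  have h6 := hR.sum_premature
  rw [hR.sum_served]
  linarith

end Trace

/-! ### Costs of an offline schedule within a time window -/

section Window

variable {n m : ℕ}

/-- The total weight of the services of `L` with times in the interval `(a, b]`. -/
noncomputable def windowSum (L : List (Service n m)) (w : Service n m → ℝ) (a b : WithBot ℝ) : ℝ :=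
  open Classical in
  (L.map fun S => if a < (S.time : WithBot ℝ) ∧ (S.time : WithBot ℝ) ≤ b then w S else 0).sum

variable {L : List (Service n m)} {w : Service n m → ℝ}

theorem windowSum_nonneg (hw : ∀ S, 0 ≤ w S) (a b : WithBot ℝ) : 0 ≤ windowSum L w a b := by
  refine List.sum_nonneg fun x hx => ?_
  obtain ⟨S, -, rfl⟩ := List.mem_map.1 hx
  split_ifs
  · exact hw S
  · exact le_rfl

theorem le_windowSum (hw : ∀ S, 0 ≤ w S) {a b : WithBot ℝ} {S : Service n m} (hS : S ∈ L)
    (ha : a < S.time) (hb : S.time ≤ b) : w S ≤ windowSum L w a b := by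
  classical
  refine List.single_le_sum (fun x hx => ?_) _ (List.mem_map.2 ⟨S, hS, if_pos ⟨ha, hb⟩⟩)
  obtain ⟨S, -, rfl⟩ := List.mem_map.1 hx
  split_ifs
  · exact hw S
  · exact le_rfl

theorem windowSum_add_le (hw : ∀ S, 0 ≤ w S) {a b c : WithBot ℝ} (hab : a ≤ b) (hbc : b ≤ c) :
    windowSum L w a b + windowSum L w b c ≤ windowSum L w a c := by
  unfold windowSum
  rw [← List.sum_map_add]
  refine List.sum_le_sum fun S _ => ?_
  have := hw S
  by_cases h1 : (S.time : WithBot ℝ) ≤ b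
  · have h2 : ¬ b < (S.time : WithBot ℝ) := not_lt.2 h1
    by_cases h3 : a < (S.time : WithBot ℝ)
    · simp [h1, h2, h3, h1.trans hbc]
    · simp [h2, h3]
  · have h2 : a < (S.time : WithBot ℝ) := hab.trans_lt (not_le.1 h1)
    have h3 : b < (S.time : WithBot ℝ) := not_le.1 h1
    simp [h1, h2, h3]

theorem windowSum_le_sum (hw : ∀ S, 0 ≤ w S) (a b : WithBot ℝ) :
    windowSum L w a b ≤ (L.map w).sum := by
  refine List.sum_le_sum fun S _ => ?_
  split_ifs
  · exact le_rfl
  · exact hw S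

/-- The cost of the item `v` in a service. -/
def itemWeight (K : Costs n) (v : Fin n) (S : Service n m) : ℝ :=
  if v ∈ S.items then K.item v else 0

theorem itemWeight_nonneg (K : Costs n) (v : Fin n) (S : Service n m) : 0 ≤ itemWeight K v S := by
  unfold itemWeight
  split_ifs
  · exact K.item_nonneg v
  · exact le_rfl

end Window

/-! ### The most recent round of a given kind -/

section Last

variable {n m : ℕ} {K : Costs n} {σ : Fin m → Request n} {k : ℕ} {R : ℕ → Round n m}

open Classical in
/-- The time of the last round before round `i` with property `q`. -/
noncomputable def lastTime (R : ℕ → Round n m) (q : Round n m → Prop) : ℕ → WithBot ℝ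
  | 0 => ⊥
  | i + 1 => if q (R i) then ((R i).time : WithBot ℝ) else lastTime R q i

open Classical in
/-- The set of requests attached by `f` to the last round before round `i` with property `q`. -/
noncomputable def lastSet (R : ℕ → Round n m) (q : Round n m → Prop)
    (f : Round n m → Finset (Fin m)) : ℕ → Finset (Fin m)
  | 0 => ∅
  | i + 1 => if q (R i) then f (R i) else lastSet R q f i

theorem Trace.lastTime_lt (hT : Trace K σ k R) (q : Round n m → Prop) {i : ℕ} (hi : i < k) :
    lastTime R q i < ((R i).time : WithBot ℝ) := by
  induction i with
  | zero => exact WithBot.bot_lt_coe _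
  | succ i ih =>
    have h := WithBot.coe_lt_coe.2 (hT.time_lt i hi)
    unfold lastTime
    split_ifs
    · exact h
    · exact (ih (by omega)).trans h

/-- The windows between successive rounds with property `q` are disjoint. -/
theorem Trace.sum_windowSum_le (hT : Trace K σ k R) (q : Round n m → Prop) [DecidablePred q]
    {L : List (Service n m)} {w : Service n m → ℝ} (hw : ∀ S, 0 ≤ w S) :
    ∑ i ∈ Finset.range k, (if q (R i) then
      windowSum L w (lastTime R q i) (R i).time else 0) ≤ (L.map w).sum := by
  suffices h : ∀ j ≤ k, ∑ i ∈ Finset.range j, (if q (R i) then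
      windowSum L w (lastTime R q i) (R i).time else 0) ≤ windowSum L w ⊥ (lastTime R q j) from
    (h k le_rfl).trans (windowSum_le_sum hw _ _)
  intro j
  induction j with
  | zero => exact fun _ => by simpa using windowSum_nonneg hw _ _
  | succ j ih =>
    intro hj
    rw [Finset.sum_range_succ, lastTime]
    have h := ih (by omega)
    split_ifs with hq
    · have := windowSum_add_le (L := L) hw bot_le (hT.lastTime_lt q (i := j) (by omega)).le
      linarith
    · simpa using h

/-- Each set is attached to at most one later round. -/
theorem sum_lastSet_le (R : ℕ → Round n m) (q : Round n m → Prop) [DecidablePred q]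
    (f : Round n m → Finset (Fin m)) {g : Fin m → ℝ} (hg : ∀ p, 0 ≤ g p) (k : ℕ) :
    ∑ i ∈ Finset.range k, (if q (R i) then ∑ p ∈ lastSet R q f i, g p else 0) ≤
      ∑ i ∈ Finset.range k, (if q (R i) then ∑ p ∈ f (R i), g p else 0) := by
  suffices h : ∑ i ∈ Finset.range k, (if q (R i) then ∑ p ∈ lastSet R q f i, g p else 0) +
      ∑ p ∈ lastSet R q f k, g p ≤
      ∑ i ∈ Finset.range k, (if q (R i) then ∑ p ∈ f (R i), g p else 0) from
    (le_add_of_nonneg_right (Finset.sum_nonneg fun p _ => hg p)).trans h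
  induction k with
  | zero => simp [lastSet]
  | succ k ih =>
    rw [Finset.sum_range_succ, Finset.sum_range_succ, lastSet]
    split_ifs with hq
    · linarith
    · linarith

theorem mem_lastSet {q : Round n m → Prop} {f : Round n m → Finset (Fin m)} {i : ℕ} {p : Fin m}
    (hp : p ∈ lastSet R q f i) : ∃ j, p ∈ f (R j) := by
  induction i with
  | zero => simp [lastSet] at hp
  | succ i ih =>
    unfold lastSet at hp
    split_ifs at hp
    · exact ⟨i, hp⟩
    · exact ih hp

/-- A request that is still pending was deferred by the last service that included its item. -/
theorem Trace.deferred (hT : Trace K σ k R) {i : ℕ} (hi : i ≤ k) {p : Fin m}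
    (hp : p ∈ (R i).pending) {τ : ℝ}
    (hτ : lastTime R (fun r => (σ p).item ∈ r.included) i = τ) :
    Deferred σ τ (K.item (σ p).item) (lastSet R (fun r => (σ p).item ∈ r.included)
      (fun r => r.localOf σ (σ p).item) i) p := by
  induction i with
  | zero => simp [lastTime] at hτ
  | succ i ih =>
    rw [hT.pending_succ i (by omega), Finset.mem_sdiff] at hp
    rw [lastTime] at hτ
    rw [lastSet]
    split_ifs at hτ ⊢ with hq
    · obtain rfl := WithBot.coe_injective hτ
      have hd : (R i).time < (σ p).deadline := by
        by_contra hd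
        exact hp.2 (Finset.mem_union_left _ (Finset.mem_filter.2 ⟨hp.1, not_lt.1 hd, hq⟩))
      refine (hT.phases i (by omega)).local_deferred p hp.1 hq hd fun hl => hp.2 ?_
      exact Finset.mem_union_right _ (Finset.mem_union_left _ hl)
    · exact ih (by omega) hp.1 hτ

end Last

/-! ### Charging to an offline schedule -/

section Charging

variable {n m : ℕ} {K : Costs n} {σ : Fin m → Request n}

/-- In the schedule `L` the request `p` is satisfied at time `o p`. -/
structure SatisfiedAt (σ : Fin m → Request n) (L : List (Service n m)) (o : Fin m → ℝ) : Prop where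
  arrival_le : ∀ p, (σ p).arrival ≤ o p
  exists_service : ∀ p, ∃ S ∈ L, p ∈ S.reqs ∧ S.time = o p ∧ (σ p).item ∈ S.items

variable {L : List (Service n m)} {o : Fin m → ℝ}

theorem SatisfiedAt.cost_nonneg (ho : SatisfiedAt σ L o) (p : Fin m) : 0 ≤ (σ p).cost (o p) :=
  (σ p).cost_nonneg _ (ho.arrival_le p)

/-- The cost is minimal at the deadline. -/
theorem cost_deadline_le {p : Request n} {t : ℝ} (ht : p.arrival ≤ t) :
    p.cost p.deadline ≤ p.cost t := by
  rcases le_total t p.deadline with h | h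
  · exact p.holding_antitone ⟨ht, h⟩ ⟨p.arrival_le_deadline, le_rfl⟩ h
  · exact p.backlog_monotone (Set.mem_Ici.2 le_rfl) h h

theorem cost_le_of_lt {p : Request n} {t x : ℝ} (hd : p.deadline ≤ t) (hx : t < x) :
    p.cost t ≤ p.cost x :=
  p.backlog_monotone hd (hd.trans hx.le) hx.le

theorem cost_le_of_le {p : Request n} {s x : ℝ} (ha : p.arrival ≤ x) (hx : x ≤ s)
    (hs : s < p.deadline) : p.cost s ≤ p.cost x :=
  p.holding_antitone ⟨ha, hx.trans hs.le⟩ ⟨ha.trans hx, hs.le⟩ hx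

/-- If the virtual deadline of a request with respect to `s` is at most `t`, then its cost at `s` is
a lower bound for its cost outside the interval `(s, t]`. -/
theorem cost_le_of_outside {p : Request n} {s t x : ℝ} (ha : p.arrival ≤ x) (hs : s < p.deadline)
    (hd : p.deadline ≤ t) (hc : p.cost s ≤ p.cost t) (hx : x ≤ s ∨ t < x) :
    p.cost s ≤ p.cost x := by
  rcases hx with hx | hx
  · exact cost_le_of_le ha hx hs
  · exact hc.trans (cost_le_of_lt hd hx)

/-- If `p` is deferred at time `s` by a holding phase that chooses `T`, and `p` and the requests in
`T` are not satisfied within `(s, t]`, but `p` is satisfied at a lower cost than at time `t`, then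
`p` or the set `T` have cost at least `c`. -/
theorem SatisfiedAt.le_of_deferred (ho : SatisfiedAt σ L o) {s t c : ℝ} {T : Finset (Fin m)}
    {p : Fin m} (hdef : Deferred σ s c T p) (hd : (σ p).deadline ≤ t)
    (hp : o p ≤ s ∨ t < o p) (hT : ∀ q ∈ T, o q ≤ s ∨ t < o q)
    (hlt : (σ p).cost (o p) < (σ p).cost t) :
    ((σ p).deadline < t ∧ c ≤ (σ p).cost (o p)) ∨ c ≤ ∑ q ∈ T, (σ q).cost (o q) := by
  have hos : o p ≤ s := hp.resolve_right fun h => absurd (cost_le_of_lt hd h) (not_le.2 hlt)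
  obtain ⟨hsd, h⟩ := hdef ((ho.arrival_le p).trans hos)
  have hcs : (σ p).cost s ≤ (σ p).cost (o p) := cost_le_of_le (ho.arrival_le p) hos hsd
  by_cases hc : (σ p).cost s ≤ c
  · obtain ⟨h1, h2⟩ := h hc
    refine Or.inr (h1.le.trans (Finset.sum_le_sum fun q hq => ?_))
    obtain ⟨-, hq2, hq3⟩ := h2 q hq
    obtain ⟨hq4, hq5⟩ := hq3 t hd (hcs.trans hlt.le)
    exact cost_le_of_outside (ho.arrival_le q) hq2 hq4 hq5 (hT q hq)
  · refine Or.inl ⟨lt_of_le_of_ne hd fun h => ?_, (not_le.1 hc).le.trans hcs⟩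
    have := cost_deadline_le (ho.arrival_le p)
    rw [h] at this
    exact absurd this (not_le.2 hlt)

/-- If the schedule has no service for `v` between the last service of `v` and `t`, then the cost
of `v` can be charged to the requests `X` or to the requests `T` of the local holding phase of the
last service. -/
theorem SatisfiedAt.item_le (ho : SatisfiedAt σ L o) {v : Fin n} {last : WithBot ℝ} {t : ℝ}
    {X T : Finset (Fin m)} (hX : ∀ p ∈ X, (σ p).item = v ∧ (σ p).deadline ≤ t)
    (hT : ∀ q ∈ T, (σ q).item = v)
    (hdef : ∀ p ∈ X, ∀ τ : ℝ, last = τ → Deferred σ τ (K.item v) T p)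
    (hout : ∀ p, (σ p).item = v → last < o p → t < o p)
    (hc : K.item v ≤ ∑ p ∈ X, (σ p).cost t) :
    K.item v ≤ ∑ p ∈ X, (σ p).cost (o p) + ∑ p ∈ T, (σ p).cost (o p) := by
  have hX0 : 0 ≤ ∑ p ∈ X, (σ p).cost (o p) := Finset.sum_nonneg fun p _ => ho.cost_nonneg p
  have hT0 : 0 ≤ ∑ p ∈ T, (σ p).cost (o p) := Finset.sum_nonneg fun p _ => ho.cost_nonneg p
  by_cases h : ∀ p ∈ X, (σ p).cost t ≤ (σ p).cost (o p)
  · linarith [Finset.sum_le_sum h]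
  · push Not at h
    obtain ⟨p, hp, hlt⟩ := h
    obtain ⟨hpv, hpd⟩ := hX p hp
    have hlast : (o p : WithBot ℝ) ≤ last := by
      by_contra hlast
      exact absurd (cost_le_of_lt hpd (hout p hpv (not_le.1 hlast))) (not_le.2 hlt)
    induction last using WithBot.recBotCoe with
    | bot => simp at hlast
    | coe τ =>
      have hout' : ∀ q, (σ q).item = v → o q ≤ τ ∨ t < o q := fun q hq =>
        (le_or_gt (o q) τ).imp_right fun h => hout q hq (WithBot.coe_lt_coe.2 h)
      rcases ho.le_of_deferred (hdef p hp τ rfl) hpd (hout' p hpv)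
        (fun q hq => hout' q (hT q hq)) hlt with h | h
      · have := Finset.single_le_sum (f := fun p => (σ p).cost (o p))
          (fun q _ => ho.cost_nonneg q) hp
        linarith [h.2]
      · linarith

/-- The cost of a service of `v` in the window, if there is one. -/
theorem SatisfiedAt.item_le_windowSum (ho : SatisfiedAt σ L o) {v : Fin n} {a : WithBot ℝ} {b : ℝ}
    {p : Fin m} (hp : (σ p).item = v) (ha : a < o p) (hb : o p ≤ b) :
    K.item v ≤ windowSum L (itemWeight K v) a b := by
  obtain ⟨S, hS, -, ht, hi⟩ := ho.exists_service p
  have := le_windowSum (itemWeight_nonneg K v) hS (a := a) (b := b) (ht ▸ ha)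
    (ht ▸ WithBot.coe_le_coe.2 hb)
  rwa [itemWeight, if_pos (hp ▸ hi)] at this

variable {k : ℕ} {R : ℕ → Round n m}

variable (K σ L o R) in
/-- What the offline schedule pays for `v` between the last service of `v` and round `i`, plus what
it pays for the requests of the local holding phase of `v` in that last service. -/
noncomputable def itemCharge (i : ℕ) (v : Fin n) : ℝ :=
  windowSum L (itemWeight K v) (lastTime R (fun r => v ∈ r.included) i) (R i).time +
    ∑ p ∈ lastSet R (fun r => v ∈ r.included) (fun r => r.localOf σ v) i, (σ p).cost (o p)

theorem SatisfiedAt.itemCharge_nonneg (ho : SatisfiedAt σ L o) (i : ℕ) (v : Fin n) :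
    0 ≤ itemCharge K σ L o R i v :=
  add_nonneg (windowSum_nonneg (itemWeight_nonneg K v) _ _)
    (Finset.sum_nonneg fun p _ => ho.cost_nonneg p)

theorem item_of_mem_lastSet {q : Round n m → Prop} {v : Fin n} {i : ℕ} {p : Fin m}
    (hp : p ∈ lastSet R q (fun r => r.localOf σ v) i) : (σ p).item = v := by
  obtain ⟨j, hj⟩ := mem_lastSet hp
  exact (Finset.mem_filter.1 hj).2

/-- The cost of a mature item can be charged to its overdue requests or to what precedes. -/
theorem Trace.item_le_of_mature (hT : Trace K σ k R) (ho : SatisfiedAt σ L o) {i : ℕ} (hi : i < k)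
    {v : Fin n} (hv : v ∈ (R i).mature) :
    K.item v ≤ itemCharge K σ L o R i v + ∑ p ∈ (R i).overdue σ {v}, (σ p).cost (o p) := by
  have h0 : 0 ≤ ∑ p ∈ (R i).overdue σ {v}, (σ p).cost (o p) :=
    Finset.sum_nonneg fun p _ => ho.cost_nonneg p
  have h1 : 0 ≤ ∑ p ∈ lastSet R (fun r => v ∈ r.included) (fun r => r.localOf σ v) i,
      (σ p).cost (o p) := Finset.sum_nonneg fun p _ => ho.cost_nonneg p
  have h2 := windowSum_nonneg (L := L) (itemWeight_nonneg K v)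
    (lastTime R (fun r => v ∈ r.included) i) (R i).time
  unfold itemCharge
  by_cases h : ∃ p, (σ p).item = v ∧ lastTime R (fun r => v ∈ r.included) i < o p ∧
      o p ≤ (R i).time
  · obtain ⟨p, hp, ha, hb⟩ := h
    linarith [ho.item_le_windowSum (K := K) hp ha hb]
  · have := ho.item_le (K := K) (v := v) (last := lastTime R (fun r => v ∈ r.included) i)
      (t := (R i).time) (X := (R i).overdue σ {v})
      (T := lastSet R (fun r => v ∈ r.included) (fun r => r.localOf σ v) i)
      (fun p hp => ⟨Finset.mem_singleton.1 (Finset.mem_filter.1 hp).2.2,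
        (Finset.mem_filter.1 hp).2.1⟩)
      (fun q hq => item_of_mem_lastSet hq)
      (fun p hp τ hτ => by
        obtain ⟨hp1, -, hp2⟩ := Finset.mem_filter.1 hp
        obtain rfl := Finset.mem_singleton.1 hp2
        exact hT.deferred hi.le hp1 hτ)
      (fun p hp hl => by
        by_contra hle
        exact h ⟨p, hp, hl, not_lt.1 hle⟩)
      (((hT.phases i hi).mem_mature v).1 hv)
    linarith

/-- What a premature item `u` of round `j` is charged to: the window of `u`, its overdue requests
and its local holding phase. -/
noncomputable def prematureCharge (K : Costs n) (σ : Fin m → Request n) (L : List (Service n m))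
    (o : Fin m → ℝ) (R : ℕ → Round n m) (j : ℕ) (u : Fin n) : ℝ :=
  itemCharge K σ L o R j u + ∑ p ∈ (R j).overdue σ {u}, (σ p).cost (o p) +
    ∑ p ∈ (R j).localOf σ u, (σ p).cost (o p)

/-- If a premature item `u` of round `j` would have become mature by the time of round `j + 1`, and
the offline schedule has no service between the two rounds, then the cost of `u` can be charged to
what precedes, to requests for `u` in the global holding phase of round `j` or to the overdue
requests for `u` of round `j + 1`. -/
theorem Trace.item_le_of_premature (hT : Trace K σ k R) (ho : SatisfiedAt σ L o) {j : ℕ}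
    (hj : j + 1 < k) (hout : ∀ p, o p ≤ (R j).time ∨ (R (j + 1)).time < o p) {u : Fin n}
    (hu : u ∈ (R j).premature)
    (hm : MatureBy K σ ((R j).active σ) (R j).time u (R (j + 1)).time) :
    K.item u ≤ prematureCharge K σ L o R j u +
      ∑ p ∈ (R j).globalReqs with (σ p).item = u, (σ p).cost (o p) +
      ∑ p ∈ (R (j + 1)).overdue σ (R (j + 1)).mature with (σ p).item = u, (σ p).cost (o p) := by
  have hph := hT.phases j (by omega)
  have hph' := hT.phases (j + 1) hj
  have hnn : ∀ s : Finset (Fin m), 0 ≤ ∑ p ∈ s, (σ p).cost (o p) := fun s =>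
    Finset.sum_nonneg fun p _ => ho.cost_nonneg p
  have hle : ∀ (s : Finset (Fin m)), ∀ p ∈ s, (σ p).cost (o p) ≤ ∑ p ∈ s, (σ p).cost (o p) :=
    fun s p hp => Finset.single_le_sum (f := fun p => (σ p).cost (o p))
      (fun q _ => ho.cost_nonneg q) hp
  have hI : u ∈ (R j).included := Finset.mem_union_right _ hu
  have hw := windowSum_nonneg (L := L) (itemWeight_nonneg K u)
    (lastTime R (fun r => u ∈ r.included) j) (R j).time
  have h1 := hnn (lastSet R (fun r => u ∈ r.included) (fun r => r.localOf σ u) j)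
  have h2 := hnn ((R j).overdue σ {u})
  have h3 := hnn ((R j).localOf σ u)
  have h4 := hnn ((R j).globalReqs.filter fun p => (σ p).item = u)
  have h5 := hnn (((R (j + 1)).overdue σ (R (j + 1)).mature).filter fun p => (σ p).item = u)
  unfold prematureCharge itemCharge
  set X := pressing σ ((R j).active σ) (R j).time u (R (j + 1)).time with hXdef
  have hX : ∀ p ∈ X, p ∈ (R j).pending ∧ (σ p).arrival ≤ (R j).time ∧ (σ p).item = u ∧
      (σ p).deadline ≤ (R (j + 1)).time ∧ ((R j).time < (σ p).deadline →
        (σ p).cost (R j).time ≤ (σ p).cost (R (j + 1)).time) := by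
    intro p hp
    obtain ⟨hp1, hp2, hp3, hp4⟩ := Finset.mem_filter.1 hp
    exact ⟨(Finset.mem_filter.1 hp1).1, (Finset.mem_filter.1 hp1).2, hp2, hp3, hp4⟩
  by_cases hw' : ∃ p, (σ p).item = u ∧ lastTime R (fun r => u ∈ r.included) j < o p ∧
      o p ≤ (R j).time
  · obtain ⟨p, hp, ha, hb⟩ := hw'
    linarith [ho.item_le_windowSum (K := K) hp ha hb]
  by_cases hl : ∀ p ∈ X, (R j).time < (σ p).deadline → p ∈ (R j).localReqs
  · -- all requests that count are satisfied by round `j` as overdue or local requests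
    have key := ho.item_le (K := K) (v := u) (last := lastTime R (fun r => u ∈ r.included) j)
      (t := (R (j + 1)).time) (X := X)
      (T := lastSet R (fun r => u ∈ r.included) (fun r => r.localOf σ u) j)
      (fun p hp => ⟨(hX p hp).2.2.1, (hX p hp).2.2.2.1⟩)
      (fun q hq => item_of_mem_lastSet hq)
      (fun p hp τ hτ => by
        obtain ⟨hp1, -, rfl, -⟩ := hX p hp
        exact hT.deferred (by omega) hp1 hτ)
      (fun p hp hl => by
        refine (hout p).resolve_left fun hle => hw' ⟨p, hp, hl, hle⟩)
      hm
    have hsub : X ⊆ (R j).overdue σ {u} ∪ (R j).localOf σ u := by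
      intro p hp
      obtain ⟨hp1, hp2, hp3, hp4, -⟩ := hX p hp
      by_cases hd : (σ p).deadline ≤ (R j).time
      · exact Finset.mem_union_left _ (Finset.mem_filter.2
          ⟨hp1, hd, Finset.mem_singleton.2 hp3⟩)
      · exact Finset.mem_union_right _ (Finset.mem_filter.2 ⟨hl p hp (not_le.1 hd), hp3⟩)
    have hdisj : Disjoint ((R j).overdue σ {u}) ((R j).localOf σ u) := by
      refine Finset.disjoint_left.2 fun p hp hp' => ?_
      have := (hph.mem_local p (Finset.mem_filter.1 hp').1).2.2.1
      exact absurd this (not_lt.2 (Finset.mem_filter.1 hp).2.1)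
    have := Finset.sum_le_sum_of_subset_of_nonneg (f := fun p => (σ p).cost (o p)) hsub
      fun q _ _ => ho.cost_nonneg q
    rw [Finset.sum_union hdisj] at this
    linarith
  · push Not at hl
    obtain ⟨p, hp, hsd, hpl⟩ := hl
    obtain ⟨hp1, hp2, hp3, hp4, hp5⟩ := hX p hp
    have hcs := cost_le_of_outside (ho.arrival_le p) hsd hp4 (hp5 hsd) (hout p)
    by_cases hc : (σ p).cost (R j).time ≤ K.item u
    · -- the local holding phase of `u` in round `j` has stopped before `p`
      obtain ⟨-, hdef⟩ := hph.local_deferred p hp1 (hp3.symm ▸ hI) hsd hpl hp2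
      rw [hp3] at hdef
      obtain ⟨hd1, hd2⟩ := hdef hc
      have : ∑ q ∈ (R j).localOf σ u, (σ q).cost (R j).time ≤
          ∑ q ∈ (R j).localOf σ u, (σ q).cost (o q) := by
        refine Finset.sum_le_sum fun q hq => ?_
        obtain ⟨-, hq2, hq3⟩ := hd2 q hq
        obtain ⟨hq4, hq5⟩ := hq3 _ hp4 (hp5 hsd)
        exact cost_le_of_outside (ho.arrival_le q) hq2 hq4 hq5 (hout q)
      linarith
    · have hcu : K.item u ≤ (σ p).cost (o p) := (not_le.1 hc).le.trans hcs
      by_cases hpg : p ∈ (R j).globalReqs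
      · have := hle ((R j).globalReqs.filter fun p => (σ p).item = u) p
          (Finset.mem_filter.2 ⟨hpg, hp3⟩)
        linarith
      · -- `p` alone makes `u` mature in round `j + 1`
        have hp' : p ∈ (R (j + 1)).pending := by
          rw [hT.pending_succ j (by omega), Finset.mem_sdiff]
          refine ⟨hp1, fun hs => ?_⟩
          rcases Finset.mem_union.1 hs with hs | hs
          · exact absurd (Finset.mem_filter.1 hs).2.1 (not_le.2 hsd)
          · exact (Finset.mem_union.1 hs).elim hpl hpg
        have hpo : p ∈ (R (j + 1)).overdue σ {u} :=
          Finset.mem_filter.2 ⟨hp', hp4, Finset.mem_singleton.2 hp3⟩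
        have hum : u ∈ (R (j + 1)).mature := by
          rw [hph'.mem_mature]
          refine ((not_le.1 hc).le.trans (hp5 hsd)).trans (Finset.single_le_sum
            (f := fun p => (σ p).cost (R (j + 1)).time) (fun q hq => ?_) hpo)
          exact cost_nonneg_of_deadline_le (Finset.mem_filter.1 hq).2.1
        have hpm : p ∈ (R (j + 1)).overdue σ (R (j + 1)).mature :=
          Finset.mem_filter.2 ⟨hp', hp4, hp3.symm ▸ hum⟩
        have := hle (((R (j + 1)).overdue σ (R (j + 1)).mature).filter fun p => (σ p).item = u) p
          (Finset.mem_filter.2 ⟨hpm, hp3⟩)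
        linarith

end Charging

/-! ### The cost of one round -/

section RoundCharge

variable {n m : ℕ} {K : Costs n} {σ : Fin m → Request n} {L : List (Service n m)} {o : Fin m → ℝ}
  {k : ℕ} {R : ℕ → Round n m}

/-- If the offline schedule has no service between two successive rounds, then it pays for the
surplus of the second round, or for the joint cost with the global holding phase of the first round
or with an early overdue request, or some item that is mature in the second round was left out of
the first one although its maturity was foreseen. -/
theorem Trace.surplus_cases (hT : Trace K σ k R) (ho : SatisfiedAt σ L o) {j : ℕ}
    (hj : j + 1 < k) (hout : ∀ p, o p ≤ (R j).time ∨ (R (j + 1)).time < o p) :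
    (R (j + 1)).surplus K σ ≤ ∑ p ∈ (R (j + 1)).overdue σ (R (j + 1)).mature, (σ p).cost (o p) ∨
    K.root ≤ ∑ p ∈ (R j).globalReqs, (σ p).cost (o p) ∨
    (∃ p ∈ (R (j + 1)).overdue σ (R (j + 1)).mature, (σ p).deadline < (R (j + 1)).time ∧
      K.root ≤ (σ p).cost (o p)) ∨
    ∃ v ∉ (R j).included, (∃ p ∈ (R j).active σ, (σ p).item = v) ∧
      MatureBy K σ ((R j).active σ) (R j).time v (R (j + 1)).time := by
  have hph := hT.phases j (by omega)
  by_contra! hcon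
  obtain ⟨hcon1, hcon2, hcon3, hcon4⟩ := hcon
  refine absurd hcon1 (not_lt.2 ?_)
  rw [(R (j + 1)).sum_overdue, Round.surplus]
  refine Finset.sum_le_sum fun v hv => ?_
  have hmem : ∀ p ∈ (R (j + 1)).overdue σ {v}, p ∈ (R (j + 1)).pending ∧
      p ∈ (R j).pending ∧ p ∉ (R j).served σ ∧ (σ p).deadline ≤ (R (j + 1)).time ∧
      (σ p).item = v := by
    intro p hp
    obtain ⟨h1, h2, h3⟩ := Finset.mem_filter.1 hp
    have h4 := h1
    rw [hT.pending_succ j (by omega), Finset.mem_sdiff] at h4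
    exact ⟨h1, h4.1, h4.2, h2, Finset.mem_singleton.1 h3⟩
  by_cases hI : v ∈ (R j).included
  · have : ∀ p ∈ (R (j + 1)).overdue σ {v},
        (σ p).cost (R (j + 1)).time ≤ (σ p).cost (o p) := by
      intro p hp
      obtain ⟨hp1, hp2, hp3, hp4, rfl⟩ := hmem p hp
      by_contra! hlt
      have hsd : (R j).time < (σ p).deadline := by
        by_contra hd
        exact hp3 (Finset.mem_union_left _ (Finset.mem_filter.2 ⟨hp2, not_lt.1 hd, hI⟩))
      have hdef := hph.global_deferred p hp2 hI hsd
        (fun h => hp3 (Finset.mem_union_right _ (Finset.mem_union_left _ h)))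
        (fun h => hp3 (Finset.mem_union_right _ (Finset.mem_union_right _ h)))
      rcases ho.le_of_deferred hdef hp4 (hout p) (fun q _ => hout q) hlt with h | h
      · exact absurd h.2 (not_le.2 (hcon3 p (Finset.mem_filter.2 ⟨hp1, hp4, hv⟩) h.1))
      · exact absurd h (not_le.2 hcon2)
    linarith [Finset.sum_le_sum this, K.item_nonneg v]
  · -- only the requests that count towards the predicted maturity are not paid for
    set X := pressing σ ((R j).active σ) (R j).time v (R (j + 1)).time with hXdef
    have hX : ∑ p ∈ X, (σ p).cost (R (j + 1)).time ≤ K.item v := by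
      by_cases hact : ∃ p ∈ (R j).active σ, (σ p).item = v
      · exact (not_le.1 (hcon4 v hI hact)).le
      · push Not at hact
        have hX0 : X = ∅ := Finset.filter_eq_empty_iff.2 fun p hp h => hact p hp h.1
        rw [hX0, Finset.sum_empty]
        exact K.item_nonneg v
    have hpaid : ∀ p ∈ (R (j + 1)).overdue σ {v} \ X,
        (σ p).cost (R (j + 1)).time ≤ (σ p).cost (o p) := by
      intro p hp
      obtain ⟨hpo, hpX⟩ := Finset.mem_sdiff.1 hp
      obtain ⟨hp1, hp2, hp3, hp4, hp5⟩ := hmem p hpo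
      rcases hout p with h | h
      · have ha : p ∈ (R j).active σ := Finset.mem_filter.2 ⟨hp2, (ho.arrival_le p).trans h⟩
        have hn : ¬ ((R j).time < (σ p).deadline →
            (σ p).cost (R j).time ≤ (σ p).cost (R (j + 1)).time) := fun hn =>
          hpX (Finset.mem_filter.2 ⟨ha, hp5, hp4, hn⟩)
        push Not at hn
        exact hn.2.le.trans (cost_le_of_le (ho.arrival_le p) h hn.1)
      · exact cost_le_of_lt hp4 h
    have hXsub : ∀ p ∈ X, 0 ≤ (σ p).cost (R (j + 1)).time := fun p hp =>
      cost_nonneg_of_deadline_le (Finset.mem_filter.1 hp).2.2.1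
    have h1 : ∑ p ∈ (R (j + 1)).overdue σ {v}, (σ p).cost (R (j + 1)).time ≤
        ∑ p ∈ (R (j + 1)).overdue σ {v} \ X, (σ p).cost (R (j + 1)).time +
          ∑ p ∈ X, (σ p).cost (R (j + 1)).time := by
      rw [← Finset.sum_inter_add_sum_sdiff _ X, add_comm]
      exact add_le_add le_rfl (Finset.sum_le_sum_of_subset_of_nonneg Finset.inter_subset_right
        fun p hp _ => hXsub p hp)
    have h2 := Finset.sum_le_sum hpaid
    have h3 := Finset.sum_le_sum_of_subset_of_nonneg (f := fun p => (σ p).cost (o p))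
      (Finset.sdiff_subset (s := (R (j + 1)).overdue σ {v}) (t := X))
      fun q _ _ => ho.cost_nonneg q
    linarith

/-- If an item is left out of a round although its maturity by the next round is foreseen, then the
joint cost can be charged, with factor one half, to the premature items that were included and to
an item that is mature in the next round. -/
theorem Trace.root_le_of_left_out (hT : Trace K σ k R) (ho : SatisfiedAt σ L o) {j : ℕ}
    (hj : j + 1 < k) (hout : ∀ p, o p ≤ (R j).time ∨ (R (j + 1)).time < o p) {v : Fin n}
    (hv : v ∉ (R j).included) (hact : ∃ p ∈ (R j).active σ, (σ p).item = v)
    (hm : MatureBy K σ ((R j).active σ) (R j).time v (R (j + 1)).time) :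
    2 * K.root ≤ ∑ u ∈ (R j).premature, prematureCharge K σ L o R j u +
      ∑ p ∈ (R j).globalReqs, (σ p).cost (o p) +
      ∑ u ∈ (R (j + 1)).mature, itemCharge K σ L o R (j + 1) u +
      ∑ p ∈ (R (j + 1)).overdue σ (R (j + 1)).mature, (σ p).cost (o p) := by
  have hph := hT.phases j (by omega)
  have hph' := hT.phases (j + 1) hj
  obtain ⟨w, hw, hlt, hmat⟩ := hph.left_out v hv hact
  obtain ⟨hP, hwm⟩ := hmat _ (hT.time_lt j hj).le hm
  set Q := (R (j + 1)).overdue σ (R (j + 1)).mature with hQ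
  have hpo : ∀ p ∈ pressing σ ((R j).active σ) (R j).time w (R (j + 1)).time,
      p ∈ (R (j + 1)).overdue σ {w} := by
    intro p hp
    obtain ⟨hp1, hp2, hp3, -⟩ := Finset.mem_filter.1 hp
    refine Finset.mem_filter.2 ⟨?_, hp3, Finset.mem_singleton.2 hp2⟩
    rw [hT.pending_succ j (by omega), Finset.mem_sdiff]
    exact ⟨(Finset.mem_filter.1 hp1).1, fun hs => hw (hp2 ▸ (hph.of_mem_served hs).2)⟩
  have hwM : w ∈ (R (j + 1)).mature := by
    rw [hph'.mem_mature]
    exact hwm.trans (Finset.sum_le_sum_of_subset_of_nonneg hpo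
      fun q hq _ => cost_nonneg_of_deadline_le (Finset.mem_filter.1 hq).2.1)
  have hc1 := hT.item_le_of_mature ho hj hwM
  have hc2 := Finset.sum_le_sum fun u hu => hT.item_le_of_premature ho hj hout hu (hP u hu)
  rw [Finset.sum_add_distrib, Finset.sum_add_distrib] at hc2
  have hwP : w ∉ (R j).premature := fun h => hw (Finset.mem_union_right _ h)
  have hfib : ∀ (I : Finset (Fin n)) (S : Finset (Fin m)),
      ∑ u ∈ I, ∑ p ∈ S with (σ p).item = u, (σ p).cost (o p) ≤ ∑ p ∈ S, (σ p).cost (o p) := by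
    intro I S
    rw [← Finset.sum_fiberwise (s := S) (g := fun p => (σ p).item)]
    exact Finset.sum_le_sum_of_subset_of_nonneg (Finset.subset_univ _)
      fun u _ _ => Finset.sum_nonneg fun p _ => ho.cost_nonneg p
  have hg := hfib (R j).premature (R j).globalReqs
  have hq := hfib (insert w (R j).premature) Q
  rw [Finset.sum_insert hwP] at hq
  have hwQ : Q.filter (fun p => (σ p).item = w) = (R (j + 1)).overdue σ {w} := by
    ext p
    simp only [hQ, Round.overdue, Finset.mem_filter, Finset.mem_singleton]
    constructor
    · rintro ⟨⟨h1, h2, -⟩, h3⟩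
      exact ⟨h1, h2, h3⟩
    · rintro ⟨h1, h2, h3⟩
      exact ⟨⟨h1, h2, h3.symm ▸ hwM⟩, h3⟩
  rw [hwQ] at hq
  have hi := Finset.single_le_sum (f := fun u => itemCharge K σ L o R (j + 1) u)
    (fun u _ => ho.itemCharge_nonneg (j + 1) u) hwM
  linarith

variable (K σ L o R) in
/-- What the premature items of the preceding round are charged to. -/
noncomputable def precedingCharge : ℕ → ℝ
  | 0 => 0
  | j + 1 => ∑ u ∈ (R j).premature, prematureCharge K σ L o R j u

theorem SatisfiedAt.prematureCharge_nonneg (ho : SatisfiedAt σ L o) (j : ℕ) (u : Fin n) :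
    0 ≤ prematureCharge K σ L o R j u :=
  add_nonneg (add_nonneg (ho.itemCharge_nonneg j u)
    (Finset.sum_nonneg fun p _ => ho.cost_nonneg p))
    (Finset.sum_nonneg fun p _ => ho.cost_nonneg p)

theorem SatisfiedAt.precedingCharge_nonneg (ho : SatisfiedAt σ L o) (i : ℕ) :
    0 ≤ precedingCharge K σ L o R i := by
  cases i with
  | zero => exact le_rfl
  | succ j => exact Finset.sum_nonneg fun u _ => ho.prematureCharge_nonneg j u

/-- The cost of a round is charged to the offline schedule: the joint cost to a service since the
preceding round, to the global holding phase of the preceding round, to the overdue requests of the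
mature items, or to the items that were premature in the preceding round. -/
theorem Trace.cost_le_charge (hT : Trace K σ k R) (ho : SatisfiedAt σ L o) {i : ℕ} (hi : i < k) :
    K.root + ∑ v ∈ (R i).included, K.item v + ∑ p ∈ (R i).served σ, (σ p).cost (R i).time ≤
      12 * windowSum L (fun _ => K.root) (lastTime R (fun _ => True) i) (R i).time +
      12 * ∑ p ∈ lastSet R (fun _ => True) Round.globalReqs i, (σ p).cost (o p) +
      10 * ∑ v ∈ (R i).mature, itemCharge K σ L o R i v +
      16 * ∑ p ∈ (R i).overdue σ (R i).mature, (σ p).cost (o p) +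
      6 * precedingCharge K σ L o R i := by
  have hcost := (hT.phases i hi).cost_le
  have hroot := hT.root_le_surplus i hi
  have hexc := hT.surplus_le i hi
  set Q := (R i).overdue σ (R i).mature with hQ
  have hmat : ∑ v ∈ (R i).mature, K.item v ≤ ∑ v ∈ (R i).mature, itemCharge K σ L o R i v +
      ∑ p ∈ Q, (σ p).cost (o p) := by
    rw [hQ, (R i).sum_overdue, ← Finset.sum_add_distrib]
    exact Finset.sum_le_sum fun v hv => hT.item_le_of_mature ho hi hv
  have hnn : ∀ s : Finset (Fin m), 0 ≤ ∑ p ∈ s, (σ p).cost (o p) := fun s =>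
    Finset.sum_nonneg fun p _ => ho.cost_nonneg p
  have hlate : ∑ p ∈ Q with (σ p).deadline = (R i).time, (σ p).cost (R i).time ≤
      ∑ p ∈ Q with (σ p).deadline = (R i).time, (σ p).cost (o p) := by
    refine Finset.sum_le_sum fun p hp => ?_
    rw [← (Finset.mem_filter.1 hp).2]
    exact cost_deadline_le (ho.arrival_le p)
  have hlateQ : ∑ p ∈ Q with (σ p).deadline = (R i).time, (σ p).cost (o p) ≤
      ∑ p ∈ Q, (σ p).cost (o p) :=
    Finset.sum_le_sum_of_subset_of_nonneg (Finset.filter_subset _ _)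
      fun p _ _ => ho.cost_nonneg p
  have n1 := windowSum_nonneg (L := L) (w := fun _ => K.root) (fun _ => K.root_pos.le)
    (lastTime R (fun _ => True) i) (R i).time
  have n2 := hnn (lastSet R (fun _ => True) Round.globalReqs i)
  have n3 : 0 ≤ ∑ v ∈ (R i).mature, itemCharge K σ L o R i v :=
    Finset.sum_nonneg fun v _ => ho.itemCharge_nonneg i v
  have n4 := hnn Q
  have n5 := ho.precedingCharge_nonneg (K := K) (R := R) i
  -- it suffices to bound the joint cost, since the excess and the mature items are paid for
  by_cases hwin : ∃ p, lastTime R (fun _ => True) i < o p ∧ o p ≤ (R i).time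
  · obtain ⟨p, ha, hb⟩ := hwin
    obtain ⟨S, hS, -, ht, -⟩ := ho.exists_service p
    have := le_windowSum (w := fun _ => K.root) (fun _ => K.root_pos.le) hS
      (a := lastTime R (fun _ => True) i) (b := (R i).time) (ht ▸ ha)
      (ht ▸ WithBot.coe_le_coe.2 hb)
    linarith
  push Not at hwin
  suffices h : (R i).surplus K σ ≤ ∑ p ∈ Q, (σ p).cost (o p) ∨
      K.root ≤ ∑ p ∈ lastSet R (fun _ => True) Round.globalReqs i, (σ p).cost (o p) ∨
      (∃ p ∈ Q, (σ p).deadline < (R i).time ∧ K.root ≤ (σ p).cost (o p)) ∨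
      2 * K.root ≤ precedingCharge K σ L o R i +
        ∑ p ∈ lastSet R (fun _ => True) Round.globalReqs i, (σ p).cost (o p) +
        ∑ v ∈ (R i).mature, itemCharge K σ L o R i v + ∑ p ∈ Q, (σ p).cost (o p) by
    rcases h with h | h | ⟨p, hp, hd, h⟩ | h
    · linarith
    · linarith
    · -- `p` is not among the requests that account for the excess of the surplus
      have : (σ p).cost (o p) + ∑ p ∈ Q with (σ p).deadline = (R i).time, (σ p).cost (o p) ≤
          ∑ p ∈ Q, (σ p).cost (o p) := by
        rw [← Finset.sum_insert (f := fun p => (σ p).cost (o p))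
          (fun hp' => hd.ne (Finset.mem_filter.1 hp').2)]
        exact Finset.sum_le_sum_of_subset_of_nonneg
          (Finset.insert_subset hp (Finset.filter_subset _ _)) fun p _ _ => ho.cost_nonneg p
      have n6 := hnn (Q.filter fun p => (σ p).deadline = (R i).time)
      linarith
    · linarith
  cases i with
  | zero =>
    refine Or.inl ?_
    rw [hQ, (R 0).sum_overdue, Round.surplus]
    refine Finset.sum_le_sum fun v _ => ?_
    have : ∀ p ∈ (R 0).overdue σ {v}, (σ p).cost (R 0).time ≤ (σ p).cost (o p) := fun p hp =>
      cost_le_of_lt (Finset.mem_filter.1 hp).2.1 (hwin p (WithBot.bot_lt_coe _))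
    linarith [Finset.sum_le_sum this, K.item_nonneg v]
  | succ j =>
    have ht : lastTime R (fun _ => True) (j + 1) = (R j).time := by simp [lastTime]
    have hs : lastSet R (fun _ => True) Round.globalReqs (j + 1) = (R j).globalReqs := by
      simp [lastSet]
    rw [hs]
    have hout : ∀ p, o p ≤ (R j).time ∨ (R (j + 1)).time < o p := fun p =>
      (le_or_gt (o p) (R j).time).imp_right fun h => hwin p (ht ▸ WithBot.coe_lt_coe.2 h)
    rcases hT.surplus_cases ho hi hout with h | h | h | ⟨v, hv, hact, hm⟩
    · exact Or.inl h
    · exact Or.inr (Or.inl h)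
    · exact Or.inr (Or.inr (Or.inl h))
    · exact Or.inr (Or.inr (Or.inr (hT.root_le_of_left_out ho hi hout hv hact hm)))

end RoundCharge

/-! ### Competitiveness -/

section Total

variable {n m : ℕ} {K : Costs n} {σ : Fin m → Request n} {L : List (Service n m)} {o : Fin m → ℝ}
  {k : ℕ} {R : ℕ → Round n m}

theorem sum_map_sum {α β : Type} [Fintype β] [DecidableEq β] (l : List α) (s : α → Finset β)
    (f : α → β → ℝ) : (l.map fun a => ∑ b ∈ s a, f a b).sum =
      ∑ b, (l.map fun a => if b ∈ s a then f a b else 0).sum := by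
  induction l with
  | nil => simp
  | cons a l ih =>
    simp only [List.map_cons, List.sum_cons, Finset.sum_add_distrib, ih]
    rw [← Finset.sum_filter, Finset.filter_univ_mem]

/-- Over all rounds, the items are charged at most once to the item costs of the offline schedule
and to the requests of each local holding phase. -/
theorem Trace.sum_itemCharge_le (hT : Trace K σ k R) (ho : SatisfiedAt σ L o) :
    ∑ i ∈ Finset.range k, ∑ v ∈ (R i).included, itemCharge K σ L o R i v ≤
      (L.map fun S => ∑ v ∈ S.items, K.item v).sum +
        ∑ i ∈ Finset.range k, ∑ p ∈ (R i).localReqs, (σ p).cost (o p) := by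
  have h1 : ∀ i ∈ Finset.range k, ∑ v ∈ (R i).included, itemCharge K σ L o R i v =
      ∑ v, ((if v ∈ (R i).included then windowSum L (itemWeight K v)
        (lastTime R (fun r => v ∈ r.included) i) (R i).time else 0) +
      if v ∈ (R i).included then ∑ p ∈ lastSet R (fun r => v ∈ r.included)
        (fun r => r.localOf σ v) i, (σ p).cost (o p) else 0) := by
    intro i _
    unfold itemCharge
    simp only [Finset.sum_add_distrib, ← Finset.sum_filter, Finset.filter_univ_mem]
  rw [Finset.sum_congr rfl h1, Finset.sum_comm]
  simp only [Finset.sum_add_distrib]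
  refine add_le_add ?_ ?_
  · rw [sum_map_sum]
    exact Finset.sum_le_sum fun v _ =>
      hT.sum_windowSum_le (fun r => v ∈ r.included) (itemWeight_nonneg K v)
  · refine (Finset.sum_le_sum fun v _ => sum_lastSet_le R (fun r => v ∈ r.included)
      (fun r => r.localOf σ v) ho.cost_nonneg k).trans ?_
    rw [Finset.sum_comm]
    refine Finset.sum_le_sum fun i hi => ?_
    rw [(hT.phases i (Finset.mem_range.1 hi)).sum_localReqs, ← Finset.sum_filter]
    simp

/-- The charges of all rounds add up to at most 16 times each part of the offline cost. -/
theorem Trace.sum_cost_le (hT : Trace K σ k R) (ho : SatisfiedAt σ L o) :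
    ∑ i ∈ Finset.range k, (K.root + ∑ v ∈ (R i).included, K.item v +
        ∑ p ∈ (R i).served σ, (σ p).cost (R i).time) ≤
      16 * ((L.map fun _ => K.root).sum + (L.map fun S => ∑ v ∈ S.items, K.item v).sum +
        ∑ p, (σ p).cost (o p)) := by
  have h := Finset.sum_le_sum fun i (hi : i ∈ Finset.range k) =>
    hT.cost_le_charge ho (Finset.mem_range.1 hi)
  simp only [Finset.sum_add_distrib, ← Finset.mul_sum] at h
  have hwin := hT.sum_windowSum_le (fun _ => True) (L := L) (w := fun _ => K.root)
    fun _ => K.root_pos.le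
  have hglob := sum_lastSet_le R (fun _ => True) Round.globalReqs ho.cost_nonneg k
  simp only [if_true] at hwin hglob
  have hitem := hT.sum_itemCharge_le ho
  have hserved := hT.sum_served_le ho.cost_nonneg
  have hsplit : ∑ i ∈ Finset.range k, ∑ p ∈ (R i).served σ, (σ p).cost (o p) =
      ∑ i ∈ Finset.range k, (∑ p ∈ (R i).overdue σ (R i).mature, (σ p).cost (o p) +
        ∑ p ∈ (R i).overdue σ (R i).premature, (σ p).cost (o p) +
        ∑ p ∈ (R i).localReqs, (σ p).cost (o p) + ∑ p ∈ (R i).globalReqs, (σ p).cost (o p)) :=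
    Finset.sum_congr rfl fun i hi => (hT.phases i (Finset.mem_range.1 hi)).sum_served _
  have hincl : ∑ i ∈ Finset.range k, ∑ v ∈ (R i).included, itemCharge K σ L o R i v =
      ∑ i ∈ Finset.range k, (∑ v ∈ (R i).mature, itemCharge K σ L o R i v +
        ∑ v ∈ (R i).premature, itemCharge K σ L o R i v) :=
    Finset.sum_congr rfl fun i hi =>
      Finset.sum_union (hT.phases i (Finset.mem_range.1 hi)).disjoint
  have hprec : ∑ i ∈ Finset.range k, precedingCharge K σ L o R i ≤
      ∑ i ∈ Finset.range k, (∑ v ∈ (R i).premature, itemCharge K σ L o R i v +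
        ∑ p ∈ (R i).overdue σ (R i).premature, (σ p).cost (o p) +
        ∑ p ∈ (R i).localReqs, (σ p).cost (o p)) := by
    have hstep : ∀ i ∈ Finset.range k, ∑ u ∈ (R i).premature, prematureCharge K σ L o R i u ≤
        ∑ v ∈ (R i).premature, itemCharge K σ L o R i v +
        ∑ p ∈ (R i).overdue σ (R i).premature, (σ p).cost (o p) +
        ∑ p ∈ (R i).localReqs, (σ p).cost (o p) := by
      intro i hi
      unfold prematureCharge
      rw [Finset.sum_add_distrib, Finset.sum_add_distrib, ← (R i).sum_overdue,
        (hT.phases i (Finset.mem_range.1 hi)).sum_localReqs]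
      exact add_le_add le_rfl (Finset.sum_le_sum_of_subset_of_nonneg Finset.subset_union_right
        fun v _ _ => Finset.sum_nonneg fun p _ => ho.cost_nonneg p)
    refine le_trans ?_ (Finset.sum_le_sum hstep)
    cases k with
    | zero => simp
    | succ k =>
      rw [Finset.sum_range_succ', Finset.sum_range_succ]
      exact add_le_add le_rfl (Finset.sum_nonneg fun u _ => ho.prematureCharge_nonneg k u)
  simp only [Finset.sum_add_distrib] at hsplit hincl hprec
  have hnn : ∀ f : ℕ → Finset (Fin m),
      0 ≤ ∑ i ∈ Finset.range k, ∑ p ∈ f i, (σ p).cost (o p) := fun f =>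
    Finset.sum_nonneg fun i _ => Finset.sum_nonneg fun p _ => ho.cost_nonneg p
  have n1 := hnn fun i => (R i).overdue σ (R i).premature
  have n2 := hnn fun i => (R i).globalReqs
  have n3 : 0 ≤ ∑ i ∈ Finset.range k, ∑ v ∈ (R i).premature, itemCharge K σ L o R i v :=
    Finset.sum_nonneg fun i _ => Finset.sum_nonneg fun v _ => ho.itemCharge_nonneg i v
  have n4 : 0 ≤ (L.map fun S => ∑ v ∈ S.items, K.item v).sum := by
    refine List.sum_nonneg fun x hx => ?_
    obtain ⟨S, -, rfl⟩ := List.mem_map.1 hx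
    exact Finset.sum_nonneg fun v _ => K.item_nonneg v
  have n5 : 0 ≤ (L.map fun _ => K.root).sum := by
    refine List.sum_nonneg fun x hx => ?_
    obtain ⟨S, -, rfl⟩ := List.mem_map.1 hx
    exact K.root_pos.le
  simp only [Finset.sum_add_distrib]
  linarith

theorem Feasible.exists_satisfiedAt (hL : Feasible σ L) : ∃ o, SatisfiedAt σ L o := by
  choose S hS hp using hL.served
  exact ⟨fun p => (S p).time, fun p => hL.arrived _ (hS p) p (hp p),
    fun p => ⟨S p, hS p, hp p, rfl, hL.item_mem _ (hS p) p (hp p)⟩⟩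

theorem SatisfiedAt.le_totalCost (ho : SatisfiedAt σ L o) (hL : Feasible σ L) :
    (L.map fun _ => K.root).sum + (L.map fun S => ∑ v ∈ S.items, K.item v).sum +
      ∑ p, (σ p).cost (o p) ≤ totalCost K σ L := by
  unfold totalCost
  rw [List.sum_map_add, List.sum_map_add]
  refine add_le_add le_rfl ?_
  rw [sum_map_sum]
  refine Finset.sum_le_sum fun p _ => ?_
  obtain ⟨S, hS, hp, ht, -⟩ := ho.exists_service p
  refine List.single_le_sum (fun x hx => ?_) _ (List.mem_map.2 ⟨S, hS, by rw [if_pos hp, ht]⟩)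
  obtain ⟨T, hT, rfl⟩ := List.mem_map.1 hx
  split_ifs with hpT
  · exact (σ p).cost_nonneg _ (hL.arrived T hT p hpT)
  · exact le_rfl

theorem fourPhase_isCompetitive : IsCompetitive 16 fourPhase := by
  intro n m K σ hurg
  obtain ⟨k, R, hT, h0, hrun, -⟩ := exists_trace hurg m (List.nodup_finRange m) (by simp)
  rw [List.toFinset_finRange] at h0
  have hval : (fourPhase K σ).val = (List.range k).map fun i => (R i).toService σ := hrun
  rw [hval]
  have hfeas := hT.feasible h0
  refine ⟨hfeas, ?_⟩
  have hcost : totalCost K σ ((List.range k).map fun i => (R i).toService σ) =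
      ∑ i ∈ Finset.range k, (K.root + ∑ v ∈ (R i).included, K.item v +
        ∑ p ∈ (R i).served σ, (σ p).cost (R i).time) := by
    unfold totalCost
    rw [List.map_map, ← List.sum_toFinset _ List.nodup_range, List.toFinset_range]
    rfl
  have hle : ∀ L, Feasible σ L →
      totalCost K σ ((List.range k).map fun i => (R i).toService σ) / 16 ≤ totalCost K σ L := by
    intro L hL
    obtain ⟨o, ho⟩ := hL.exists_satisfiedAt
    have := hT.sum_cost_le ho
    have := ho.le_totalCost (K := K) hL
    linarith
  have : totalCost K σ ((List.range k).map fun i => (R i).toService σ) / 16 ≤ optCost K σ := by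
    refine le_csInf ⟨_, _, hfeas, rfl⟩ ?_
    rintro x ⟨L, hL, rfl⟩
    exact hle L hL
  linarith

end Total

end JRP

theorem mainTheorem2 :
    JRP.IsCompetitive 16 JRP.fourPhase ∧ JRP.IsOnline JRP.fourPhase ∧
      JRP.RunsInPolynomialTime JRP.fourPhase :=
  ⟨JRP.fourPhase_isCompetitive, JRP.fourPhase_isOnline, JRP.fourPhase_runsInPolynomialTime⟩
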